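/- Let $\hbar,\epsilon$ be commuting formal variables, $\mathbb{Q}_\hbar[z]=\mathbb{Q}[z][[\hbar]]$ and $\mathbb{K}=\mathbb{Q}_\hbar[\epsilon]=\mathbb{Q}[\epsilon][[\hbar]]$. Let $\mathbb{D}$ be the $\hbar$-adically complete $\mathbb{K}$-algebra topologically generated by $\mathbf y,\mathbf b,\mathbf a,\mathbf x$ subject to the relations $$\mathbf x\mathbf y=q\,\mathbf y\mathbf x+\frac{1-\mathbf A\mathbf B}{\hbar},\quad [\mathbf a,\mathbf x]=\mathbf x,\quad [\mathbf b,\mathbf x]=\epsilon\mathbf x,\quad [\mathbf a,\mathbf y]=-\mathbf y,\quad [\mathbf b,\mathbf y]=-\epsilon\mathbf y,\quad [\mathbf a,\mathbf b]=0,$$ where $q=e^{\epsilon\hbar}$, $\mathbf A=e^{-\epsilon\hbar\mathbf a}$, $\mathbf B=e^{-\hbar\mathbf b}$; that is, $\mathbb{D}$ is the quotient of $\mathbb{Q}[\epsilon]\langle \mathbf y,\mathbf b,\mathbf a,\mathbf x\rangle[[\hbar]]$ by the $\hbar$-adic closure of the two-sided ideal generated by these relations. Let $\mathcal Z(\mathbb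 D)$ be its center. 1. The element $\mathbf t=\mathbf b-\epsilon\mathbf a$ is central. Put $\mathbf T=e^{-\hbar\mathbf t}$. 2. There is a unique element $\mathbf c\in\mathbb D$ with $\hbar(q-1)\,\mathbf c=q\mathbf A^{-1}+\mathbf A\mathbf T-\tfrac12(1+\mathbf T)(q+1)$, and the element $$\mathbf w=\mathbf y\mathbf A^{-1}\mathbf x+\mathbf c=\mathbf y\mathbf A^{-1}\mathbf x+\frac{q\mathbf A^{-1}+\mathbf A\mathbf T-\frac12(1+\mathbf T)(q+1)}{\hbar(q-1)}$$ is central and satisfies $\mathbf w\equiv \mathbf y\mathbf x+g(\mathbf a,\mathbf t)\pmod \hbar$ for some power series $g\in\mathbb{Q}_\hbar[\epsilon,a,t]=\mathbb{Q}[\epsilon,a,t][[\hbar]]$. 3. Let $\tilde{\mathbf w}\in\mathbb D$ be any central element with $\tilde{\mathbf w}\equiv\mathbf y\mathbf x+g(\mathbf a,\mathbf t)\pmod\hbar$ for some $g\in\mathbb{Q}_\hbar[\epsilon,a,t]$. Then $\mathcal Z(\mathbb D)$ is topologically generated by $\mathbf t,\tilde{\mathbf w}$ as an algebra over $\mathbb{Q}_\hbar[\epsilon]$: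 the elements of $\mathcal Z(\mathbb D)$ are exactly the elements of $\mathbb{D}$ that can be written as an $\hbar$-adically convergent series $\sum_{n\ge0}p_n\hbar^n$, where each $p_n$ is a polynomial in $\mathbf t,\tilde{\mathbf w}$ with coefficients in $\mathbb{Q}[\epsilon]$. -/

import Mathlib

noncomputable section

namespace QDouble

/-! ## Base ring and power series in `ħ` -/

/-- The polynomial ring `ℚ[ε]`. -/
abbrev QEps : Type := Polynomial ℚ

/-- The base ring `𝕂 = ℚ_ħ[ε] = ℚ[ε]⟦ħ⟧`. -/
abbrev K : Type := PowerSeries QEps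

/-- The series `e^{ħ u} = ∑ₙ uⁿ / n! ħⁿ`, with `ħ` a central variable. -/
def hexp {R : Type*} [Ring R] [Algebra ℚ R] (u : R) : PowerSeries R :=
  PowerSeries.mk fun n => ((n.factorial : ℚ)⁻¹) • u ^ n

/-- Division by `ħ` of a series in `ħ` without constant term (the constant term is dropped). -/
def divH {R : Type*} [Ring R] (f : PowerSeries R) : PowerSeries R :=
  PowerSeries.mk fun n => PowerSeries.coeff (n + 1) f

/-- For a series without constant term, `divH` is the division by `ħ`. -/
theorem X_mul_divH {R : Type*} [Ring R] (f : PowerSeries R)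
    (hf : PowerSeries.coeff 0 f = 0) : PowerSeries.X * divH f = f := by
  ext n
  cases n with
  | zero => rw [hf]; simp
  | succ n => simp [divH, PowerSeries.coeff_succ_X_mul]

theorem hexp_mul_hexp_neg {R : Type*} [Ring R] [Algebra ℚ R] (u : R) :
    hexp u * hexp (-u) = 1 := by
  have key : (hexp (Polynomial.X : Polynomial ℚ)) * hexp (-Polynomial.X) = 1 := by
    have h1 : ∀ v : Polynomial ℚ,
        hexp v = PowerSeries.rescale v (PowerSeries.exp (Polynomial ℚ)) := by
      intro v
      ext1 n
      simp [hexp, PowerSeries.coeff_exp, Algebra.smul_def, mul_comm]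
    rw [h1, h1, PowerSeries.exp_mul_exp_eq_exp_add]
    simp
  have h2 : ∀ v : Polynomial ℚ, PowerSeries.map
      ((Polynomial.aeval u : Polynomial ℚ →ₐ[ℚ] R) : Polynomial ℚ →+* R) (hexp v)
        = hexp (Polynomial.aeval u v) := by
    intro v
    ext n
    simp [hexp]
  have h3 := congrArg (PowerSeries.map
      ((Polynomial.aeval u : Polynomial ℚ →ₐ[ℚ] R) : Polynomial ℚ →+* R)) key
  rw [map_mul, h2, h2, map_one] at h3
  simpa using h3

/-! ## The completed free algebra -/

/-- The four generators. -/
inductive Gen : Type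
  | y | b | a | x

/-- The free algebra `ℚ[ε]⟨y, b, a, x⟩`. -/
abbrev Free : Type := FreeAlgebra QEps Gen

/-- The `ħ`-adically complete free `𝕂`-algebra `ℚ[ε]⟨y, b, a, x⟩⟦ħ⟧`: series in the central
variable `ħ` whose coefficients are non-commutative polynomials in the generators. -/
abbrev FreeHat : Type := PowerSeries Free

/-- The scalar `ε` in the free algebra. -/
def fε : Free := algebraMap QEps Free Polynomial.X

/-- A generator in the free algebra. -/
def gen (i : Gen) : Free := FreeAlgebra.ι QEps i

/-- A generator as a constant series. -/
def genHat (i : Gen) : FreeHat := PowerSeries.C (gen i)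

/-- `ε` as a constant series. -/
def εHat : FreeHat := PowerSeries.C fε

/-- `q = e^{εħ}`. -/
def qHat : FreeHat := hexp fε

/-- `A = e^{-εħa}`. -/
def AHat : FreeHat := hexp (-(fε * gen Gen.a))

/-- `B = e^{-ħb}`. -/
def BHat : FreeHat := hexp (-gen Gen.b)

/-- `1 - AB` has no constant term, so that `divH (1 - AB)` is `(1 - AB)/ħ`. -/
theorem coeff_zero_one_sub : PowerSeries.coeff 0 (1 - AHat * BHat) = 0 := by
  simp [AHat, BHat, hexp]

/-- The defining relations (left side minus right side):
`xy = q yx + (1 - AB)/ħ`, `[a,x] = x`, `[b,x] = εx`, `[a,y] = -y`, `[b,y] = -εy`, `[a,b] = 0`. -/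
def relators : Set FreeHat :=
  { genHat .x * genHat .y - (qHat * genHat .y * genHat .x + divH (1 - AHat * BHat)),
    genHat .a * genHat .x - genHat .x * genHat .a - genHat .x,
    genHat .b * genHat .x - genHat .x * genHat .b - εHat * genHat .x,
    genHat .a * genHat .y - genHat .y * genHat .a + genHat .y,
    genHat .b * genHat .y - genHat .y * genHat .b + εHat * genHat .y,
    genHat .a * genHat .b - genHat .b * genHat .a }

/-- The `ħ`-adic closure of the two-sided ideal generated by the relations: the intersection
over all `n` of the two-sided ideals generated by the relations and `ħⁿ`. -/
def relIdeal : TwoSidedIdeal FreeHat :=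
  ⨅ n : ℕ, TwoSidedIdeal.span (relators ∪ {(PowerSeries.X : FreeHat) ^ n})

/-! ## The algebra `𝔻` -/

/-- The algebra `𝔻`: the `ħ`-adically complete algebra (topologically) generated by `y, b, a, x`
subject to the relations above. -/
def D : Type := relIdeal.ringCon.Quotient

instance instRingD : Ring D := inferInstanceAs (Ring relIdeal.ringCon.Quotient)

/-- The projection from the completed free algebra. -/
def proj : FreeHat →+* D := relIdeal.ringCon.mk'

theorem proj_surjective : Function.Surjective proj := Quotient.mk_surjective

/-- The scalars `𝕂 → ℚ[ε]⟨y, b, a, x⟩⟦ħ⟧`. -/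
def scalarHat : K →+* FreeHat := PowerSeries.map (algebraMap QEps Free)

theorem scalarHat_comm (c : K) (f : FreeHat) : scalarHat c * f = f * scalarHat c := by
  ext1 n
  rw [PowerSeries.coeff_mul, PowerSeries.coeff_mul, ← Finset.Nat.sum_antidiagonal_swap]
  refine Finset.sum_congr rfl fun p _ => ?_
  simp only [scalarHat, PowerSeries.coeff_map, Prod.fst_swap, Prod.snd_swap]
  exact Algebra.commutes _ _

/-- `𝔻` is an algebra over `𝕂 = ℚ[ε]⟦ħ⟧`. -/
instance instAlgebraKD : Algebra K D :=
  (proj.comp scalarHat).toAlgebra' fun c d => by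
    obtain ⟨f, rfl⟩ := proj_surjective d
    rw [RingHom.comp_apply, ← map_mul, ← map_mul, scalarHat_comm]

/-- `𝔻` as an algebra over `ℚ[ε] ⊆ 𝕂`. -/
instance instAlgebraQEpsD : Algebra QEps D :=
  ((algebraMap K D).comp (PowerSeries.C (R := QEps))).toAlgebra' fun c d =>
    Algebra.commutes (R := K) (PowerSeries.C c) d

/-- `𝔻` as an algebra over `ℚ ⊆ ℚ[ε]`. -/
instance instAlgebraRatD : Algebra ℚ D :=
  ((algebraMap QEps D).comp (Polynomial.C (R := ℚ))).toAlgebra' fun c d =>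
    Algebra.commutes (R := QEps) (Polynomial.C c) d

/-- The element `ħ` of `𝔻`. -/
def ħ : D := algebraMap K D PowerSeries.X

/-- The element `ε` of `𝔻`. -/
def ε : D := algebraMap QEps D Polynomial.X

/-- The generator `y` of `𝔻`. -/
def y : D := proj (genHat .y)

/-- The generator `b` of `𝔻`. -/
def b : D := proj (genHat .b)

/-- The generator `a` of `𝔻`. -/
def a : D := proj (genHat .a)

/-- The generator `x` of `𝔻`. -/
def x : D := proj (genHat .x)

/-- `q = e^{εħ}` in `𝔻`. -/
def q : D := proj qHat

/-- `A = e^{-εħa}` in `𝔻`. -/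
def A : D := proj AHat

/-- `A⁻¹ = e^{εħa}` in `𝔻`. -/
def Ainv : D := proj (hexp (fε * gen .a))

theorem A_mul_Ainv : A * Ainv = 1 := by
  have h := hexp_mul_hexp_neg (-(fε * gen .a))
  rw [neg_neg] at h
  rw [A, Ainv, AHat, ← map_mul, h, map_one]

theorem Ainv_mul_A : Ainv * A = 1 := by
  rw [A, Ainv, AHat, ← map_mul, hexp_mul_hexp_neg, map_one]

/-- `t = b - εa`. -/
def t : D := b - ε * a

/-- `T = e^{-ħt}` in `𝔻`. -/
def T : D := proj (hexp (-(gen .b - fε * gen .a)))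

/-! ## Series in `a, t`, and topological generation -/

/-- The value at `(a, b - εa)` in the free algebra of a polynomial in two variables over `ℚ[ε]`
(with the powers of `a` written first; `a` and `t` commute in `𝔻`). -/
def evalAT (g : MvPolynomial (Fin 2) QEps) : Free :=
  ∑ m ∈ g.support, MvPolynomial.coeff m g • (gen .a ^ m 0 * (gen .b - fε * gen .a) ^ m 1)

/-- The element `g(a,t) = ∑ₙ gₙ(a,t) ħⁿ` of `𝔻`, for a power series `g = ∑ₙ gₙ ħⁿ` in
`ℚ_ħ[ε, a, t] = ℚ[ε, a, t]⟦ħ⟧`. -/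
def seriesAT (g : PowerSeries (MvPolynomial (Fin 2) QEps)) : D :=
  proj (PowerSeries.mk fun n => evalAT (PowerSeries.coeff n g))

/-- Congruence modulo `ħ` in `𝔻`. -/
def CongrModH (u v : D) : Prop := ħ ∣ u - v

/-- `z = ∑ₙ pₙ ħⁿ`, with convergence in the `ħ`-adic topology of `𝔻`. -/
def IsHSum (p : ℕ → D) (z : D) : Prop :=
  ∀ N : ℕ, ħ ^ N ∣ z - ∑ n ∈ Finset.range N, p n * ħ ^ n

/-- A `𝕂`-subalgebra `Z` of `𝔻` is topologically generated by `S`: its elements are exactly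
the convergent series in `ħ` whose coefficients are (non-commutative) polynomials in the
elements of `S` with coefficients in `ℚ[ε]`. -/
def IsTopologicallyGeneratedBy (Z : Subalgebra K D) (S : Set D) : Prop :=
  ∀ z : D, z ∈ Z ↔ ∃ p : ℕ → D, (∀ n, p n ∈ Algebra.adjoin QEps S) ∧ IsHSum p z

end QDouble

end

open QDouble

/-! The algebra `D` embeds in series over a skew Laurent ring whose centre is visible. Adjoin to
`ℚ[ε][t][w][a]` an invertible `X` with `X f(a) = f(a - 1) X`, so that `t` and `w` commute with
everything. Send `a ↦ a`, `b ↦ t + εa`, `x ↦ X`, `y ↦ u X⁻¹`, where `u` is solved from `w = y A⁻¹ x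
+ c`. The relation for `xy` becomes a difference equation for `u`, which follows from `ħ (c(a) - c(a
- 1)) = A⁻¹ - A T` (`casimirP_sub_shift`). This gives `toSkewH`.

The map is injective (`toSkewH_injective`). Modulo `ħ`, every element is a combination of terms
`f(t,w,a) xⁿ` and `f(t,w,a) yⁿ`, with `w` the classical Casimir element (`lift_mem_range`). Their
images lie in distinct powers of `X` with nonzero coefficients (`eq_zero_of_map_eq_zero`). Since `D`
is `ħ`-adically separated and `ħ` is cancellable in the target, injectivity modulo `ħ` is enough.
Centrality of `t` and `w` and uniqueness of `c` are then read off in the image.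

For the centre, work modulo `ħ`: commuting with `a` leaves only the power `X⁰`, and commuting with
`x` makes its coefficient periodic in `a`, hence free of `a`. Central elements thus reduce into
`ℚ[ε][t][w]`. There `w'` becomes `w` plus a polynomial in `t`, so `t, w'` generate this ring
(`exists_mem_adjoin`). Subtracting a polynomial in `t, w'` and dividing by `ħ` leaves a central
element, and iteration produces the series. -/

noncomputable section

namespace QDouble

/-! ## Extending homomorphisms to series in `ħ` -/

section SeriesLift

variable {R S : Type*} [Ring R] [Ring S] (φ : R →+* PowerSeries S)

/-- The extension of `φ : R →+* S⟦ħ⟧` to polynomials in `ħ`. -/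
def polyLift : Polynomial R →+* PowerSeries S :=
  Polynomial.eval₂RingHom' φ PowerSeries.X fun _ => PowerSeries.commute_X _

theorem polyLift_C (r : R) : polyLift φ (Polynomial.C r) = φ r := Polynomial.eval₂_C _ _

theorem polyLift_X : polyLift φ Polynomial.X = PowerSeries.X := Polynomial.eval₂_X _ _

/-- `ħ` goes to `ħ`, so a difference divisible by `ħ^(n+1)` does not reach coefficient `n`. -/
theorem coeff_polyLift_congr {p p' : Polynomial R} {n : ℕ}
    (h : ∀ i ≤ n, p.coeff i = p'.coeff i) :
    PowerSeries.coeff n (polyLift φ p) = PowerSeries.coeff n (polyLift φ p') := by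
  have hd : Polynomial.X ^ (n + 1) ∣ p - p' := by
    rw [Polynomial.X_pow_dvd_iff]
    intro d hd
    rw [Polynomial.coeff_sub, h d (by omega), sub_self]
  obtain ⟨r, hr⟩ := hd
  rw [← sub_eq_zero, ← map_sub, ← map_sub, hr, map_mul, map_pow, polyLift_X]
  exact (PowerSeries.X_pow_dvd_iff.mp (Dvd.intro _ rfl)) n (Nat.lt_succ_self n)

/-- The `ħ`-adically continuous extension of `φ : R →+* S⟦ħ⟧` to `R⟦ħ⟧`, as a function. -/
def seriesLiftFun (f : PowerSeries R) : PowerSeries S :=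
  PowerSeries.mk fun n => PowerSeries.coeff n (polyLift φ (f.trunc (n + 1)))

/-- The freedom in `p` is needed for multiplicativity: a product of truncations is not the
truncation of the product, but agrees with it far enough. -/
theorem coeff_seriesLiftFun {f : PowerSeries R} {p : Polynomial R} {n : ℕ}
    (h : ∀ i ≤ n, p.coeff i = PowerSeries.coeff i f) :
    PowerSeries.coeff n (seriesLiftFun φ f) = PowerSeries.coeff n (polyLift φ p) := by
  rw [seriesLiftFun, PowerSeries.coeff_mk]
  refine coeff_polyLift_congr φ fun i hi => ?_
  rw [h i hi, PowerSeries.coeff_trunc, if_pos (by omega)]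

theorem coeff_trunc_of_le (f : PowerSeries R) {i n : ℕ} (h : i ≤ n) :
    (f.trunc (n + 1)).coeff i = PowerSeries.coeff i f := by
  rw [PowerSeries.coeff_trunc, if_pos (by omega)]

/-- The `ħ`-adically continuous extension of `φ : R →+* S⟦ħ⟧` to `R⟦ħ⟧`. -/
def seriesLift : PowerSeries R →+* PowerSeries S where
  toFun := seriesLiftFun φ
  map_zero' := by
    ext n
    rw [coeff_seriesLiftFun φ (p := 0) (by simp), map_zero]
  map_one' := by
    ext n
    rw [coeff_seriesLiftFun φ (p := 1)
      (by simp [Polynomial.coeff_one, PowerSeries.coeff_one]), map_one]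
  map_add' f g := by
    ext n
    rw [coeff_seriesLiftFun φ (p := f.trunc (n + 1) + g.trunc (n + 1)), map_add, map_add, map_add,
      ← coeff_seriesLiftFun φ fun i hi => coeff_trunc_of_le f hi,
      ← coeff_seriesLiftFun φ fun i hi => coeff_trunc_of_le g hi]
    intro i hi
    simp only [Polynomial.coeff_add, coeff_trunc_of_le _ hi, map_add]
  map_mul' f g := by
    ext n
    rw [coeff_seriesLiftFun φ (p := f.trunc (n + 1) * g.trunc (n + 1)), map_mul,
      PowerSeries.coeff_mul, PowerSeries.coeff_mul]
    · refine Finset.sum_congr rfl fun p hp => ?_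
      have := Finset.HasAntidiagonal.mem_antidiagonal.mp hp
      rw [← coeff_seriesLiftFun φ fun i hi => coeff_trunc_of_le f (by omega),
        ← coeff_seriesLiftFun φ fun i hi => coeff_trunc_of_le g (by omega)]
    · intro i hi
      rw [Polynomial.coeff_mul, PowerSeries.coeff_mul]
      refine Finset.sum_congr rfl fun p hp => ?_
      have := Finset.HasAntidiagonal.mem_antidiagonal.mp hp
      rw [coeff_trunc_of_le _ (by omega), coeff_trunc_of_le _ (by omega)]

theorem seriesLift_C (r : R) : seriesLift φ (PowerSeries.C r) = φ r := by
  ext n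
  refine (coeff_seriesLiftFun φ (p := Polynomial.C r) fun i _ => ?_).trans (by rw [polyLift_C])
  simp [Polynomial.coeff_C, PowerSeries.coeff_C]

theorem seriesLift_X : seriesLift φ PowerSeries.X = PowerSeries.X := by
  ext n
  refine (coeff_seriesLiftFun φ (p := Polynomial.X) fun i _ => ?_).trans (by rw [polyLift_X])
  simp [Polynomial.coeff_X, PowerSeries.coeff_X, eq_comm]

/-- Meant for series in `a`, `b`, `ε`, whose images are constant in `ħ`; the image of `y` is not. -/
theorem seriesLift_of_const {f : PowerSeries R} {g : PowerSeries S}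
    (h : ∀ n, φ (PowerSeries.coeff n f) = PowerSeries.C (PowerSeries.coeff n g)) :
    seriesLift φ f = g := by
  ext n
  refine (coeff_seriesLiftFun φ fun i hi => coeff_trunc_of_le f hi).trans ?_
  change PowerSeries.coeff n (Polynomial.eval₂ φ PowerSeries.X (f.trunc (n + 1))) = _
  rw [Polynomial.eval₂_eq_sum_range' (n := n + 1) _ (PowerSeries.natDegree_trunc_lt f n), map_sum, Finset.sum_eq_single n]
  · rw [coeff_trunc_of_le _ le_rfl, h, PowerSeries.coeff_C_mul, PowerSeries.coeff_X_pow_self,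
      mul_one]
  · intro i hi hne
    have := Finset.mem_range.mp hi
    rw [coeff_trunc_of_le _ (by omega), h, PowerSeries.coeff_C_mul, PowerSeries.coeff_X_pow,
      if_neg (Ne.symm hne), mul_zero]
  · simp

end SeriesLift

/-! ## Exponential series -/

section Exponentials

theorem map_hexp {R S : Type*} [Ring R] [Ring S] [Algebra ℚ R] [Algebra ℚ S] (f : R →+* S)
    (u : R) : PowerSeries.map f (hexp u) = hexp (f u) := by
  ext n
  simp [hexp, map_rat_smul f]

variable {M : Type*} [CommRing M] [Algebra ℚ M]

theorem hexp_eq_rescale (v : M) : hexp v = PowerSeries.rescale v (PowerSeries.exp M) := by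
  ext1 n
  simp [hexp, PowerSeries.coeff_exp, Algebra.smul_def, mul_comm]

theorem hexp_mul_hexp (u v : M) : hexp u * hexp v = hexp (u + v) := by
  simp only [hexp_eq_rescale, PowerSeries.exp_mul_exp_eq_exp_add]

/-- The quotient `(e^{ħεv} - 1) / (ħε)`. -/
def hexpQuot (e v : M) : PowerSeries M :=
  PowerSeries.mk fun n => (((n + 1).factorial : ℚ)⁻¹) • (e ^ n * v ^ (n + 1))

/-- Isolating `ħε` allows division by `q - 1` without inverting `ε`: the remaining factor `hexpQuot
e 1` has constant term `1`. -/
theorem hexp_sub_one (e v : M) :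
    hexp (e * v) - 1 = PowerSeries.X * (PowerSeries.C e * hexpQuot e v) := by
  ext n
  cases n with
  | zero => simp [hexp]
  | succ n =>
    rw [PowerSeries.coeff_succ_X_mul, PowerSeries.coeff_C_mul, map_sub]
    simp only [hexp, hexpQuot, PowerSeries.coeff_mk, PowerSeries.coeff_one]
    rw [if_neg (Nat.succ_ne_zero n), sub_zero, mul_smul_comm]
    congr 1
    ring

/-- The series `c(a,t)` with `ħ (q - 1) c = q A⁻¹ + A T - (1 + T) (q + 1) / 2`. -/
def casimirSeries (e a t : M) : PowerSeries M :=
  PowerSeries.invOfUnit (hexpQuot e 1) 1 *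
    divH (hexpQuot e (a + 1) + hexpQuot e (-a) * hexp (-t)
      - (1 / 2 : ℚ) • ((1 + hexp (-t)) * hexpQuot e 1))

theorem hexpQuot_one_mul_inv (e : M) :
    hexpQuot e 1 * PowerSeries.invOfUnit (hexpQuot e 1) 1 = 1 := by
  apply PowerSeries.mul_invOfUnit
  simp [hexpQuot, ← PowerSeries.coeff_zero_eq_constantCoeff_apply]

/-- The right side equals `(q A⁻¹ - 1) + (A - 1) T - (1 + T)(q - 1)/2`, and each summand contains
`ħε`. What remains has constant term `(a + 1) - a - 1 = 0`, hence a second factor `ħ`; this is where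
the `1/2` matters. -/
theorem casimirSeries_spec (e a t : M) :
    PowerSeries.X * (hexp e - 1) * casimirSeries e a t =
      hexp e * hexp (e * a) + hexp (-(e * a)) * hexp (-t)
        - (1 / 2 : ℚ) • ((1 + hexp (-t)) * (hexp e + 1)) := by
  have h0 := X_mul_divH (hexpQuot e (a + 1) + hexpQuot e (-a) * hexp (-t)
      - (1 / 2 : ℚ) • ((1 + hexp (-t)) * hexpQuot e 1)) (by
    simp [hexpQuot, hexp]
    rw [← add_smul]
    norm_num)
  have h1 := hexp_sub_one e 1
  have h2 := hexp_sub_one e (a + 1)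
  have h3 := hexp_sub_one e (-a)
  have h4 := hexpQuot_one_mul_inv e
  rw [mul_one] at h1
  rw [mul_add, mul_one, ← add_comm e, ← hexp_mul_hexp] at h2
  rw [mul_neg] at h3
  rw [casimirSeries]
  generalize divH (R := M) _ = d at h0 ⊢
  generalize PowerSeries.invOfUnit (R := M) _ _ = i at h4 ⊢
  rw [Algebra.smul_def] at h0 ⊢
  have h5 : algebraMap ℚ (PowerSeries M) (1 / 2) * 2 = 1 := by
    rw [← map_ofNat (algebraMap ℚ (PowerSeries M)) 2, ← map_mul]
    norm_num
  generalize algebraMap ℚ (PowerSeries M) (1 / 2) = k at h0 h5 ⊢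
  rw [h1]
  rw [← sub_eq_zero] at h1 h2 h3 ⊢
  linear_combination (exp := 1) (PowerSeries.X * PowerSeries.C e) * h0
    + PowerSeries.X ^ 2 * PowerSeries.C e * d * h4 - h2 - h3 * hexp (-t)
    + k * (1 + hexp (-t)) * h1 + (1 + hexp (-t)) * h5

theorem coeff_zero_casimirSeries (e a t : M) :
    PowerSeries.coeff 0 (casimirSeries e a t) = t * a + e * a * (a + 1) + (1 / 2 : ℚ) • t := by
  have h : PowerSeries.constantCoeff (PowerSeries.invOfUnit (hexpQuot e 1) 1) = 1 := by simp
  rw [casimirSeries, PowerSeries.coeff_zero_eq_constantCoeff_apply, map_mul, h, one_mul,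
    ← PowerSeries.coeff_zero_eq_constantCoeff_apply]
  simp only [divH, PowerSeries.coeff_mk, map_add, map_sub, PowerSeries.coeff_mul, hexpQuot, hexp,
    Finset.Nat.antidiagonal_succ, Finset.Nat.antidiagonal_zero, PowerSeries.coeff_smul]
  simp [Nat.factorial, Algebra.smul_def, PowerSeries.coeff_one, one_add_one_eq_two]
  have h5 : algebraMap ℚ M 2⁻¹ * 2 = 1 := by
    rw [← map_ofNat (algebraMap ℚ M) 2, ← map_mul]
    norm_num
  generalize algebraMap ℚ M 2⁻¹ = k at h5 ⊢
  linear_combination (e * a ^ 2 + e * a - k * e) * h5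

end Exponentials

/-! ## The skew Laurent ring over `ℚ[ε][t][w][a]` -/

/-- The polynomial ring `ℚ[ε][t][w]`. -/
def PolyTW : Type := Polynomial (Polynomial QEps)

instance : CommRing PolyTW := inferInstanceAs (CommRing (Polynomial (Polynomial QEps)))

instance : IsDomain PolyTW := inferInstanceAs (IsDomain (Polynomial (Polynomial QEps)))

instance : Algebra QEps PolyTW := inferInstanceAs (Algebra QEps (Polynomial (Polynomial QEps)))

instance : Algebra ℚ PolyTW := inferInstanceAs (Algebra ℚ (Polynomial (Polynomial QEps)))

instance : CharZero PolyTW := algebraRat.charZero PolyTW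

/-- The variable `t` in `ℚ[ε][t][w]`. -/
def tTW : PolyTW := (Polynomial.C Polynomial.X : Polynomial (Polynomial QEps))

/-- The variable `w` in `ℚ[ε][t][w]`. -/
def wTW : PolyTW := (Polynomial.X : Polynomial (Polynomial QEps))

theorem algebraMap_polyTW_injective : Function.Injective (algebraMap QEps PolyTW) :=
  (Polynomial.C_injective (R := Polynomial QEps)).comp Polynomial.C_injective

/-- The polynomial ring `ℚ[ε][t][w][a]`. -/
abbrev PolyTWA : Type := Polynomial PolyTW

/-- The scalar `ε` in `ℚ[ε][t][w][a]`. -/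
def eP : PolyTWA := algebraMap QEps PolyTWA Polynomial.X

/-- The variable `t` in `ℚ[ε][t][w][a]`. -/
def tP : PolyTWA := Polynomial.C tTW

/-- The variable `w` in `ℚ[ε][t][w][a]`. -/
def wP : PolyTWA := Polynomial.C wTW

/-- The variable `a` in `ℚ[ε][t][w][a]`. -/
def aP : PolyTWA := Polynomial.X

/-- The translation `a ↦ a - n`. -/
def shift (n : ℤ) : PolyTWA →+* PolyTWA :=
  (Polynomial.taylorAlgHom (-(n : PolyTW))).toRingHom

theorem shift_apply (n : ℤ) (p : PolyTWA) : shift n p = Polynomial.taylor (-(n : PolyTW)) p := rfl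

@[simp] theorem shift_C (n : ℤ) (c : PolyTW) : shift n (Polynomial.C c) = Polynomial.C c :=
  Polynomial.taylor_C _ _

@[simp] theorem shift_eP (n : ℤ) : shift n eP = eP := shift_C n _

@[simp] theorem shift_tP (n : ℤ) : shift n tP = tP := shift_C n _

@[simp] theorem shift_wP (n : ℤ) : shift n wP = wP := shift_C n _

@[simp] theorem shift_aP (n : ℤ) : shift n aP = aP - (n : PolyTWA) := by
  rw [shift_apply, aP, Polynomial.taylor_X, map_neg, map_intCast, sub_eq_add_neg]

theorem shift_add (m n : ℤ) (p : PolyTWA) : shift (m + n) p = shift m (shift n p) := by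
  simp only [shift_apply, Polynomial.taylor_taylor]
  push_cast
  rw [neg_add]

theorem shift_zero (p : PolyTWA) : shift 0 p = p := by
  simp [shift_apply]

theorem shift_injective (n : ℤ) : Function.Injective (shift n) := Polynomial.taylor_injective _

/-- The group `ℤ` acts on `ℚ[ε][t][w][a]` by translations of `a`. -/
instance shiftAction : MulSemiringAction (Multiplicative ℤ) PolyTWA where
  smul n p := shift n.toAdd p
  one_smul p := shift_zero p
  mul_smul _ _ p := shift_add _ _ p
  smul_zero n := map_zero (shift n.toAdd)
  smul_add n := map_add (shift n.toAdd)
  smul_one n := map_one (shift n.toAdd)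
  smul_mul n := map_mul (shift n.toAdd)

theorem ofAdd_smul (n : ℤ) (p : PolyTWA) : Multiplicative.ofAdd n • p = shift n p := rfl

theorem shift_algebraMap (n : ℤ) (c : QEps) :
    shift n (algebraMap QEps PolyTWA c) = algebraMap QEps PolyTWA c :=
  shift_C n _

instance : SMulCommClass (Multiplicative ℤ) QEps PolyTWA where
  smul_comm n c p := by
    change shift n.toAdd (c • p) = c • shift n.toAdd p
    rw [Algebra.smul_def, map_mul, shift_algebraMap, ← Algebra.smul_def]

instance : SMulCommClass (Multiplicative ℤ) ℚ PolyTWA where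
  smul_comm n c p := map_rat_smul (shift n.toAdd) c p

/-- The skew Laurent ring in `X` over `ℚ[ε][t][w][a]`, with `X f(a) = f(a - 1) X`. -/
abbrev Skew : Type := SkewMonoidAlgebra PolyTWA (Multiplicative ℤ)

/-- The inclusion of the coefficients. -/
def diag : PolyTWA →+* Skew := SkewMonoidAlgebra.singleOneRingHom

/-- The power `Xⁿ`. -/
def shiftOp (n : ℤ) : Skew := SkewMonoidAlgebra.single (Multiplicative.ofAdd n) 1

theorem diag_apply (p : PolyTWA) : diag p = SkewMonoidAlgebra.single 1 p := rfl

theorem diag_mul_shiftOp (p : PolyTWA) (n : ℤ) :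
    diag p * shiftOp n = SkewMonoidAlgebra.single (Multiplicative.ofAdd n) p := by
  rw [diag_apply, shiftOp, SkewMonoidAlgebra.single_mul_single, one_mul, one_smul, mul_one]

theorem shiftOp_mul_diag (n : ℤ) (p : PolyTWA) :
    shiftOp n * diag p = diag (shift n p) * shiftOp n := by
  rw [diag_mul_shiftOp, diag_apply, shiftOp, SkewMonoidAlgebra.single_mul_single, mul_one, one_mul,
    ofAdd_smul]

theorem shiftOp_mul (m n : ℤ) : shiftOp m * shiftOp n = shiftOp (m + n) := by
  rw [shiftOp, shiftOp, shiftOp, SkewMonoidAlgebra.single_mul_single, smul_one, mul_one, ofAdd_add]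

theorem shiftOp_zero : shiftOp 0 = 1 := rfl

theorem diag_injective : Function.Injective diag := SkewMonoidAlgebra.single_injective _

theorem coeff_diag_mul (p : PolyTWA) (f : Skew) (g : Multiplicative ℤ) :
    (diag p * f).coeff g = p * f.coeff g :=
  SkewMonoidAlgebra.coeff_single_one_mul _ _ _

theorem coeff_mul_diag (p : PolyTWA) (f : Skew) (g : Multiplicative ℤ) :
    (f * diag p).coeff g = f.coeff g * shift g.toAdd p :=
  SkewMonoidAlgebra.coeff_mul_single_one _ _ _

/-- A coefficient that does not involve `a` is central in the skew Laurent ring. -/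
theorem diag_C_comm (c : PolyTW) (f : Skew) :
    diag (Polynomial.C c) * f = f * diag (Polynomial.C c) := by
  ext1 g
  rw [coeff_diag_mul, coeff_mul_diag, shift_C, mul_comm]

theorem algebraMap_skew (c : QEps) : algebraMap QEps Skew c = diag (algebraMap QEps PolyTWA c) :=
  rfl

/-! ## Series in `ħ` over the skew Laurent ring -/

/-- The inclusion of the series in `ħ` with coefficients in `ℚ[ε][t][w][a]`. -/
def diagH : PowerSeries PolyTWA →+* PowerSeries Skew := PowerSeries.map diag

/-- The power `Xⁿ` as a constant series. -/
def shiftH (n : ℤ) : PowerSeries Skew := PowerSeries.C (shiftOp n)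

theorem diagH_C (p : PolyTWA) : diagH (PowerSeries.C p) = PowerSeries.C (diag p) :=
  PowerSeries.map_C _ _

theorem diagH_X : diagH PowerSeries.X = PowerSeries.X := PowerSeries.map_X _

theorem shiftH_mul_diagH (n : ℤ) (f : PowerSeries PolyTWA) :
    shiftH n * diagH f = diagH (PowerSeries.map (shift n) f) * shiftH n := by
  ext1 k
  rw [shiftH, PowerSeries.coeff_C_mul, PowerSeries.coeff_mul_C]
  exact shiftOp_mul_diag _ _

theorem shiftH_mul (m n : ℤ) : shiftH m * shiftH n = shiftH (m + n) := by
  rw [shiftH, shiftH, shiftH, ← map_mul, shiftOp_mul]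

theorem shiftH_zero : shiftH 0 = 1 := by rw [shiftH, shiftOp_zero, map_one]

/-- The series `c(a,t)` over `ℚ[ε][t][w][a]`. -/
def casimirP : PowerSeries PolyTWA := casimirSeries eP aP tP

theorem eP_ne_zero : eP ≠ 0 := by
  rw [eP, Polynomial.algebraMap_apply, Ne, Polynomial.C_eq_zero,
    map_eq_zero_iff _ algebraMap_polyTW_injective]
  exact Polynomial.X_ne_zero

theorem hexp_eP_sub_one_ne_zero : hexp eP - 1 ≠ 0 := by
  intro h
  have := congrArg (PowerSeries.coeff 1) h
  simp [hexp, PowerSeries.coeff_one] at this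
  exact eP_ne_zero this

/-- The translation turns `q A⁻¹` into `A⁻¹` and `A T` into `q A T` and fixes the last term, so the
numerator changes by `(q - 1)(A⁻¹ - A T)`. -/
theorem casimirP_sub_shift :
    PowerSeries.X * (casimirP - PowerSeries.map (shift 1) casimirP) =
      hexp (eP * aP) - hexp (-(eP * aP)) * hexp (-tP) := by
  have h1 := casimirSeries_spec eP aP tP
  have h2 := congrArg (PowerSeries.map (shift 1)) h1
  rw [← casimirP] at h1 h2
  simp only [map_mul, map_sub, map_add, map_one, map_rat_smul, map_hexp, PowerSeries.map_X,
    map_neg, shift_aP, shift_eP, shift_tP, Int.cast_one] at h2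
  have h3 : hexp eP * hexp (eP * (aP - 1)) = hexp (eP * aP) := by
    rw [hexp_mul_hexp]; congr 1; ring
  have h4 : hexp (-(eP * (aP - 1))) = hexp eP * hexp (-(eP * aP)) := by
    rw [hexp_mul_hexp]; congr 1; ring
  rw [h3, h4] at h2
  apply mul_left_cancel₀ hexp_eP_sub_one_ne_zero
  linear_combination h1 - h2

/-- The coefficient `u` in `y = u X⁻¹`. -/
def yCoeff : PowerSeries PolyTWA :=
  (PowerSeries.C wP - casimirP) * hexp (-(eP * (aP + 1)))

/-- With `x = X` and `y = u X⁻¹`, the products `xy` and `yx` are `u(a - 1)` and `u(a)`, so this is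
the relation for `xy`. The exponential in `u` comes from `X⁻¹ A⁻¹ X = e^{εħ(a+1)}`. -/
theorem shift_yCoeff_sub :
    PowerSeries.map (shift 1) yCoeff - hexp eP * yCoeff =
      divH (1 - hexp (-(eP * aP)) * hexp (-(tP + eP * aP))) := by
  have h0 := X_mul_divH (1 - hexp (-(eP * aP)) * hexp (-(tP + eP * aP))) (by simp [hexp])
  apply PowerSeries.X_mul_cancel
  rw [h0, yCoeff]
  simp only [map_mul, map_sub, map_add, map_one, map_hexp, PowerSeries.map_C,
    map_neg, shift_aP, shift_eP, shift_wP, Int.cast_one, sub_add_cancel]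
  have h1 : hexp eP * hexp (-(eP * (aP + 1))) = hexp (-(eP * aP)) := by
    rw [hexp_mul_hexp]; congr 1; ring
  have h2 : hexp (-(tP + eP * aP)) = hexp (-(eP * aP)) * hexp (-tP) := by
    rw [hexp_mul_hexp]; congr 1; ring
  have h3 := hexp_mul_hexp_neg (eP * aP)
  rw [h2]
  linear_combination hexp (-(eP * aP)) * casimirP_sub_shift + h3
    - PowerSeries.X * (PowerSeries.C wP - casimirP) * h1

/-! ## The homomorphism from the completed free algebra -/

/-- The images of the generators. -/
def genImage : Gen → PowerSeries Skew
  | .y => diagH yCoeff * shiftH (-1)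
  | .b => PowerSeries.C (diag (tP + eP * aP))
  | .a => PowerSeries.C (diag aP)
  | .x => shiftH 1

/-- The homomorphism from the free algebra to the series over the skew Laurent ring. -/
def freeToSkew : Free →ₐ[QEps] PowerSeries Skew := FreeAlgebra.lift QEps genImage

/-- The homomorphism from the completed free algebra to the series over the skew Laurent ring. -/
def freeHatToSkew : FreeHat →+* PowerSeries Skew := seriesLift freeToSkew.toRingHom

theorem freeToSkew_gen (i : Gen) : freeToSkew (gen i) = genImage i := FreeAlgebra.lift_ι_apply _ _

theorem freeToSkew_algebraMap (c : QEps) :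
    freeToSkew (algebraMap QEps Free c) = PowerSeries.C (diag (algebraMap QEps PolyTWA c)) := by
  rw [AlgHom.commutes, PowerSeries.algebraMap_apply, algebraMap_skew]

theorem freeToSkew_fε : freeToSkew fε = PowerSeries.C (diag eP) := freeToSkew_algebraMap _

theorem freeHatToSkew_C (r : Free) : freeHatToSkew (PowerSeries.C r) = freeToSkew r :=
  seriesLift_C _ _

theorem freeHatToSkew_X : freeHatToSkew PowerSeries.X = PowerSeries.X := seriesLift_X _

theorem freeHatToSkew_genHat (i : Gen) : freeHatToSkew (genHat i) = genImage i := by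
  rw [genHat, freeHatToSkew_C, freeToSkew_gen]

theorem freeHatToSkew_hexp {u : Free} {p : PolyTWA}
    (h : freeToSkew u = PowerSeries.C (diag p)) : freeHatToSkew (hexp u) = diagH (hexp p) := by
  refine seriesLift_of_const _ fun n => ?_
  change freeToSkew _ = _
  rw [diagH, PowerSeries.coeff_map, hexp, hexp, PowerSeries.coeff_mk, PowerSeries.coeff_mk, map_rat_smul freeToSkew,
    map_pow, h, map_rat_smul diag, map_rat_smul PowerSeries.C, map_pow, map_pow]

theorem freeHatToSkew_divH {f : FreeHat} {g : PowerSeries PolyTWA}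
    (hf : PowerSeries.coeff 0 f = 0) (hg : PowerSeries.coeff 0 g = 0)
    (h : freeHatToSkew f = diagH g) : freeHatToSkew (divH f) = diagH (divH g) := by
  apply PowerSeries.X_mul_cancel
  rw [← freeHatToSkew_X, ← map_mul, X_mul_divH f hf, h, freeHatToSkew_X, ← diagH_X, ← map_mul,
    X_mul_divH g hg]

theorem freeHatToSkew_qHat : freeHatToSkew qHat = diagH (hexp eP) :=
  freeHatToSkew_hexp freeToSkew_fε

theorem freeHatToSkew_AHat : freeHatToSkew AHat = diagH (hexp (-(eP * aP))) :=
  freeHatToSkew_hexp (by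
    rw [map_neg, map_mul, freeToSkew_fε, freeToSkew_gen, genImage, map_neg, map_mul, map_neg,
      map_mul])

theorem freeHatToSkew_BHat : freeHatToSkew BHat = diagH (hexp (-(tP + eP * aP))) :=
  freeHatToSkew_hexp (by rw [map_neg, freeToSkew_gen, genImage, map_neg, map_neg])

theorem freeHatToSkew_εHat : freeHatToSkew εHat = diagH (PowerSeries.C eP) := by
  rw [εHat, freeHatToSkew_C, freeToSkew_fε, diagH_C]

theorem freeHatToSkew_relators {r : FreeHat} (hr : r ∈ relators) : freeHatToSkew r = 0 := by
  -- The relations of `x` with `a` and with `b` are the cases `r = 1` and `r = ε`; likewise for `y`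
  -- in `hy`.
  have hx : ∀ p r, shift 1 p = p - r → diagH (PowerSeries.C p) * shiftH 1 -
      shiftH 1 * diagH (PowerSeries.C p) - diagH (PowerSeries.C r) * shiftH 1 = 0 := by
    intro p r h
    rw [shiftH_mul_diagH, PowerSeries.map_C, h, ← sub_mul, ← sub_mul]
    simp
  have hy : ∀ p r, shift (-1) p = p + r → diagH (PowerSeries.C p) * (diagH yCoeff * shiftH (-1)) -
      diagH yCoeff * shiftH (-1) * diagH (PowerSeries.C p) +
      diagH (PowerSeries.C r) * (diagH yCoeff * shiftH (-1)) = 0 := by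
    intro p r h
    rw [mul_assoc, shiftH_mul_diagH, PowerSeries.map_C, h]
    simp only [← mul_assoc, ← map_mul]
    rw [← sub_mul, ← add_mul, ← map_sub, ← map_add]
    convert zero_mul _
    rw [map_eq_zero_iff diagH (PowerSeries.map_injective _ diag_injective), map_add]
    ring
  rcases hr with rfl | rfl | rfl | rfl | rfl | rfl
  · have hd : freeHatToSkew (divH (1 - AHat * BHat)) =
        diagH (divH (1 - hexp (-(eP * aP)) * hexp (-(tP + eP * aP)))) := by
      apply freeHatToSkew_divH coeff_zero_one_sub (by simp [hexp])
      rw [map_sub, map_one, map_mul, freeHatToSkew_AHat, freeHatToSkew_BHat, map_sub, map_one,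
        map_mul]
    rw [map_sub, map_add, map_mul, map_mul, map_mul, hd, ← shift_yCoeff_sub, freeHatToSkew_qHat]
    simp only [freeHatToSkew_genHat, genImage]
    rw [← mul_assoc, shiftH_mul_diagH, mul_assoc, shiftH_mul, mul_assoc, mul_assoc, shiftH_mul]
    norm_num [shiftH_zero]
  · have := hx aP 1 (by simp)
    rw [map_one, map_one, one_mul, diagH_C] at this
    simpa only [map_sub, map_mul, freeHatToSkew_genHat, genImage] using this
  · have := hx (tP + eP * aP) eP (by simp; ring)
    rw [diagH_C (tP + eP * aP)] at this
    simpa only [map_sub, map_mul, freeHatToSkew_genHat, genImage, freeHatToSkew_εHat] using this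
  · have := hy aP 1 (by simp)
    rw [map_one, map_one, one_mul, diagH_C] at this
    simpa only [map_sub, map_add freeHatToSkew, map_mul, freeHatToSkew_genHat, genImage] using this
  · have := hy (tP + eP * aP) eP (by simp; ring)
    rw [diagH_C (tP + eP * aP)] at this
    simpa only [map_sub, map_add freeHatToSkew, map_mul, freeHatToSkew_genHat, genImage,
      freeHatToSkew_εHat] using this
  · simp only [map_sub, map_mul, freeHatToSkew_genHat, genImage]
    rw [← map_mul, ← map_mul, ← map_mul, ← map_mul, mul_comm, sub_self]

/-- Accounts for the closure of the ideal: an element lying in all these ideals has an image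
divisible by every power of `ħ`. -/
theorem X_pow_dvd_freeHatToSkew {n : ℕ} {f : FreeHat}
    (hf : f ∈ TwoSidedIdeal.span (relators ∪ {(PowerSeries.X : FreeHat) ^ n})) :
    PowerSeries.X ^ n ∣ freeHatToSkew f := by
  induction hf using TwoSidedIdeal.span_induction with
  | mem f hf =>
    rcases hf with hf | rfl
    · rw [freeHatToSkew_relators hf]
      exact dvd_zero _
    · rw [map_pow, freeHatToSkew_X]
  | zero => simp
  | add f g _ _ hf hg => rw [map_add]; exact dvd_add hf hg
  | neg f _ hf => rw [map_neg]; exact dvd_neg.mpr hf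
  | left_absorb f g _ hg =>
    rw [map_mul]
    obtain ⟨d, hd⟩ := hg
    rw [hd, ← mul_assoc, (PowerSeries.commute_X_pow _ n).eq, mul_assoc]
    exact dvd_mul_right _ _
  | right_absorb f g _ hg =>
    rw [map_mul]
    exact hg.mul_right _

theorem freeHatToSkew_eq_zero {f : FreeHat} (hf : f ∈ relIdeal) : freeHatToSkew f = 0 := by
  ext1 n
  rw [relIdeal, TwoSidedIdeal.mem_iInf] at hf
  rw [map_zero]
  exact PowerSeries.X_pow_dvd_iff.mp (X_pow_dvd_freeHatToSkew (hf (n + 1))) n n.lt_succ_self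

/-- The homomorphism from `𝔻` to the series over the skew Laurent ring. -/
def toSkewH : D →+* PowerSeries Skew :=
  relIdeal.ringCon.lift freeHatToSkew fun f g h => by
    rw [RingCon.ker_apply, ← sub_eq_zero, ← map_sub]
    exact freeHatToSkew_eq_zero ((TwoSidedIdeal.rel_iff _ _ _).mp h)

theorem toSkewH_proj (f : FreeHat) : toSkewH (proj f) = freeHatToSkew f := rfl

/-! ## The classical limit -/

/-- The relations of the classical limit `ħ = 0`, in terms of `y, t, a, x` with `t = b - εa`. -/
structure ClassicalRel {R : Type*} [Ring R] [Algebra QEps R] (y t a x : R) : Prop where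
  x_mul_y : x * y = y * x + (t + algebraMap QEps R Polynomial.X * a
    + algebraMap QEps R Polynomial.X * a)
  x_mul_a : x * a = (a - 1) * x
  y_mul_a : y * a = (a + 1) * y
  x_mul_t : x * t = t * x
  y_mul_t : y * t = t * y
  a_mul_t : a * t = t * a

theorem commute_eval₂ {R S : Type*} [Semiring R] [Semiring S] (f : R →+* S) {s z : S}
    (hf : ∀ r, Commute (f r) z) (hs : Commute s z) (p : Polynomial R) :
    Commute (p.eval₂ f s) z := by
  induction p using Polynomial.induction_on' with
  | add p q hp hq => rw [Polynomial.eval₂_add]; exact hp.add_left hq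
  | monomial n r => rw [Polynomial.eval₂_monomial]; exact (hf r).mul_left (hs.pow_left n)

namespace ClassicalRel

section

variable {R : Type*} [Ring R] {y x : R}

/-- The powers `xᵐ` for `m ≥ 0` and `y⁻ᵐ` for `m ≤ 0`. -/
def zpower (y x : R) (m : ℤ) : R := x ^ m.toNat * y ^ (-m).toNat

theorem zpower_natCast (n : ℕ) : zpower y x (n : ℤ) = x ^ n := by simp [zpower]

theorem zpower_neg_natCast (n : ℕ) : zpower y x (-(n : ℤ)) = y ^ n := by simp [zpower]

/-- `v` is a product of translates of `u`, nonzero in a domain. -/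
theorem exists_diag_mul_shiftOp_pow {u : PolyTWA} (hu : u ≠ 0) (n : ℕ) :
    ∃ v ≠ 0, (diag u * shiftOp (-1)) ^ n = diag v * shiftOp (-(n : ℤ)) := by
  induction n with
  | zero => exact ⟨1, one_ne_zero, by simp [shiftOp_zero]⟩
  | succ n ih =>
    obtain ⟨v, hv, e⟩ := ih
    refine ⟨v * shift (-(n : ℤ)) u,
      mul_ne_zero hv fun h0 => hu (shift_injective _ (h0.trans (map_zero _).symm)), ?_⟩
    rw [pow_succ, e, mul_assoc, ← mul_assoc (shiftOp _), shiftOp_mul_diag, mul_assoc, shiftOp_mul,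
      ← mul_assoc, ← map_mul]
    congr 2
    push_cast
    ring

theorem exists_map_zpower (ρ : R →+* Skew) {u : PolyTWA} (hu : u ≠ 0) (hx : ρ x = shiftOp 1)
    (hy : ρ y = diag u * shiftOp (-1)) (m : ℤ) :
    ∃ v ≠ 0, ρ (zpower y x m) = diag v * shiftOp m := by
  obtain ⟨n, rfl | rfl⟩ := m.eq_nat_or_neg
  · refine ⟨1, one_ne_zero, ?_⟩
    rw [zpower_natCast, map_pow, hx, map_one, one_mul]
    induction n with
    | zero => exact pow_zero _
    | succ n ih => rw [pow_succ, ih, shiftOp_mul, Nat.cast_succ]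
  · rw [zpower_neg_natCast, map_pow, hy]
    exact exists_diag_mul_shiftOp_pow hu n

end

/-! ### The classical Casimir element and normal forms -/

section

variable {R : Type*} [Ring R] [Algebra QEps R] {y t a x : R}

/-- The classical Casimir element minus `yx`. -/
def shiftTerm (t a : R) : R :=
  t * a + algebraMap QEps R Polynomial.X * a * (a + 1)
    + algebraMap QEps R (Polynomial.C (1 / 2)) * t

/-- The classical Casimir element. -/
def casimir (y t a x : R) : R := y * x + shiftTerm t a

theorem semiconj_scalar (c : QEps) (r : R) :
    SemiconjBy r (algebraMap QEps R c) (algebraMap QEps R c) := Algebra.commute_algebraMap_right c r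

/-- Moving `x` across replaces `a` by `a - 1`, and `shiftTerm t a - shiftTerm t (a - 1) = t + 2εa`
is exactly `xy - yx`. -/
theorem x_mul_casimir (h : ClassicalRel y t a x)
    : x * casimir y t a x = casimir y t a x * x := by
  have h1 : SemiconjBy x a (a - 1) := h.x_mul_a
  have h2 : SemiconjBy x t t := h.x_mul_t
  have h3 : SemiconjBy x (shiftTerm t a) (shiftTerm t (a - 1)) :=
    ((h2.mul_right h1).add_right (((semiconj_scalar _ x).mul_right h1).mul_right
      (h1.add_right (SemiconjBy.one_right x)))).add_right ((semiconj_scalar _ x).mul_right h2)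
  rw [casimir, mul_add, h3.eq, ← mul_assoc, h.x_mul_y, ← add_mul, shiftTerm, shiftTerm]
  congr 1
  noncomm_ring

theorem y_mul_casimir (h : ClassicalRel y t a x)
    : y * casimir y t a x = casimir y t a x * y := by
  have h1 : SemiconjBy y (a - 1) a := by
    rw [SemiconjBy, mul_sub, h.y_mul_a]
    noncomm_ring
  have h2 : SemiconjBy y t t := h.y_mul_t
  have h3 : SemiconjBy y (shiftTerm t (a - 1)) (shiftTerm t a) :=
    ((h2.mul_right h1).add_right (((semiconj_scalar _ y).mul_right h1).mul_right
      (h1.add_right (SemiconjBy.one_right y)))).add_right ((semiconj_scalar _ y).mul_right h2)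
  rw [casimir, add_mul, ← h3.eq, mul_assoc, h.x_mul_y, ← mul_add, shiftTerm, shiftTerm]
  congr 1
  noncomm_ring

theorem commute_casimir_of
    {z : R} (hz : Commute z (y * x)) (ht : Commute z t)
    (ha : Commute z a) : Commute z (casimir y t a x) :=
  hz.add_right (((ht.mul_right ha).add_right (((semiconj_scalar _ z).mul_right ha).mul_right
      (ha.add_right (Commute.one_right z)))).add_right ((semiconj_scalar _ z).mul_right ht))

theorem commute_t_casimir (h : ClassicalRel y t a x) : Commute t (casimir y t a x) := by
  refine commute_casimir_of (Commute.mul_right ?_ ?_) (Commute.refl t) ?_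
  · exact h.y_mul_t.symm
  · exact h.x_mul_t.symm
  · exact h.a_mul_t.symm

theorem commute_a_casimir (h : ClassicalRel y t a x) : Commute a (casimir y t a x) := by
  refine commute_casimir_of ?_ h.a_mul_t (Commute.refl a)
  have h1 : SemiconjBy y (a - 1) a := by
    rw [SemiconjBy, mul_sub, h.y_mul_a]
    noncomm_ring
  rw [Commute, SemiconjBy, ← mul_assoc, ← h1.eq, mul_assoc, ← h.x_mul_a, mul_assoc]

/-- Evaluation of polynomials in `t, w`. -/
def evalTW (h : ClassicalRel y t a x) : PolyTW →+* R :=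
  Polynomial.eval₂RingHom' (Polynomial.aeval t : Polynomial QEps →ₐ[QEps] R).toRingHom
    (casimir y t a x) fun p => commute_eval₂ _ (fun r => (Algebra.commute_algebraMap_left r _))
      h.commute_t_casimir p

theorem commute_evalTW (h : ClassicalRel y t a x)
    {z : R} (ht : Commute t z) (hw : Commute (casimir y t a x) z)
    (p : PolyTW) : Commute (h.evalTW p) z :=
  commute_eval₂ _ (fun q => commute_eval₂ _ (fun r => (Algebra.commute_algebraMap_left r _)) ht q)
    hw p

/-- Evaluation of polynomials in `t, w, a`. -/
def evalTWA (h : ClassicalRel y t a x) : PolyTWA →+* R :=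
  Polynomial.eval₂RingHom' h.evalTW a
    fun p => h.commute_evalTW h.a_mul_t.symm h.commute_a_casimir.symm p

theorem evalTWA_C (h : ClassicalRel y t a x)
    (p : PolyTW) : h.evalTWA (Polynomial.C p) = h.evalTW p := Polynomial.eval₂_C _ _

theorem evalTWA_aP (h : ClassicalRel y t a x) : h.evalTWA aP = a := Polynomial.eval₂_X _ _

theorem evalTWA_wP (h : ClassicalRel y t a x) : h.evalTWA wP = casimir y t a x :=
  (h.evalTWA_C _).trans (Polynomial.eval₂_X _ _)

theorem evalTWA_tP (h : ClassicalRel y t a x) : h.evalTWA tP = t :=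
  (h.evalTWA_C _).trans ((Polynomial.eval₂_C _ _).trans (Polynomial.aeval_X t))

theorem evalTWA_algebraMap (h : ClassicalRel y t a x) (c : QEps) :
    h.evalTWA (algebraMap QEps PolyTWA c) = algebraMap QEps R c :=
  (h.evalTWA_C _).trans ((Polynomial.eval₂_C _ _).trans (Polynomial.aeval_C t c))

theorem semiconj_evalTWA (h : ClassicalRel y t a x) {z : R} {n : ℤ} (ht : z * t = t * z)
    (hw : z * casimir y t a x = casimir y t a x * z) (ha : z * a = (a - (n : R)) * z)
    (p : PolyTWA) : z * h.evalTWA p = h.evalTWA (shift n p) * z := by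
  have hC : ∀ c, SemiconjBy z (h.evalTWA (Polynomial.C c)) (h.evalTWA (Polynomial.C c)) := by
    intro c
    rw [h.evalTWA_C]
    exact (h.commute_evalTW ht.symm hw.symm c).symm
  have hX : SemiconjBy z (h.evalTWA aP) (h.evalTWA (aP - (n : PolyTWA))) := by
    rw [map_sub, map_intCast, h.evalTWA_aP]
    exact ha
  change SemiconjBy z _ _
  induction p using Polynomial.induction_on' with
  | add p q hp hq => rw [map_add, map_add, map_add]; exact hp.add_right hq
  | monomial k c =>
    rw [← Polynomial.C_mul_X_pow_eq_monomial, map_mul, map_mul, map_mul, map_pow, map_pow, map_pow,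
      shift_C]
    change SemiconjBy z _ (_ * (h.evalTWA (shift n aP)) ^ k)
    rw [shift_aP]
    exact (hC c).mul_right (hX.pow_right k)

theorem x_mul_evalTWA (h : ClassicalRel y t a x)
    (p : PolyTWA) : x * h.evalTWA p = h.evalTWA (shift 1 p) * x :=
  h.semiconj_evalTWA h.x_mul_t h.x_mul_casimir (by simpa using h.x_mul_a) p

theorem y_mul_evalTWA (h : ClassicalRel y t a x)
    (p : PolyTWA) : y * h.evalTWA p = h.evalTWA (shift (-1) p) * y :=
  h.semiconj_evalTWA h.y_mul_t h.y_mul_casimir (by simpa using h.y_mul_a) p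

/-- The linear combination of the `zpower`s with given coefficients. -/
def normalForm (h : ClassicalRel y t a x) : (ℤ →₀ PolyTWA) →+ R :=
  Finsupp.liftAddHom fun m => (AddMonoidHom.mulRight (zpower y x m)).comp h.evalTWA.toAddMonoidHom

theorem normalForm_single (h : ClassicalRel y t a x) (m : ℤ) (p : PolyTWA) :
    h.normalForm (Finsupp.single m p) = h.evalTWA p * zpower y x m := by
  simp [normalForm]

theorem normalForm_apply (h : ClassicalRel y t a x) (p : ℤ →₀ PolyTWA) :
    h.normalForm p = p.sum fun m f => h.evalTWA f * zpower y x m := rfl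

theorem mem_range (h : ClassicalRel y t a x) (m : ℤ) (p : PolyTWA) :
    h.evalTWA p * zpower y x m ∈ h.normalForm.range :=
  ⟨_, h.normalForm_single m p⟩

theorem eval_mul_mem_range (h : ClassicalRel y t a x)
    (f : PolyTWA) {r : R} (hr : r ∈ h.normalForm.range) :
    h.evalTWA f * r ∈ h.normalForm.range := by
  obtain ⟨p, rfl⟩ := hr
  rw [normalForm_apply, Finsupp.mul_sum]
  refine sum_mem fun m _ => ?_
  beta_reduce
  rw [← mul_assoc, ← map_mul]
  exact h.mem_range _ _

/-- Having `w` among the variables makes `yx`, and then `xy`, a coefficient. Hence mixed words in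
`x` and `y` collapse to powers of one of them. -/
theorem exists_yx (h : ClassicalRel y t a x) : ∃ f, h.evalTWA f = y * x := by
  refine ⟨wP - (tP * aP + algebraMap QEps _ Polynomial.X * aP * (aP + 1)
    + algebraMap QEps _ (Polynomial.C (1 / 2)) * tP), ?_⟩
  simp only [map_sub, map_add, map_mul, evalTWA_wP, evalTWA_tP, evalTWA_aP, evalTWA_algebraMap,
    map_one]
  rw [casimir, shiftTerm]
  abel

theorem exists_xy (h : ClassicalRel y t a x) : ∃ f, h.evalTWA f = x * y := by
  obtain ⟨f, hf⟩ := h.exists_yx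
  refine ⟨f + (tP + algebraMap QEps _ Polynomial.X * aP + algebraMap QEps _ Polynomial.X * aP), ?_⟩
  rw [h.x_mul_y]
  simp only [map_add, map_mul, hf, evalTWA_tP, evalTWA_aP, evalTWA_algebraMap]

theorem x_mul_mem_range (h : ClassicalRel y t a x)
    {r : R} (hr : r ∈ h.normalForm.range) : x * r ∈ h.normalForm.range := by
  obtain ⟨p, rfl⟩ := hr
  rw [normalForm_apply, Finsupp.mul_sum]
  refine sum_mem fun m _ => ?_
  beta_reduce
  rw [← mul_assoc, h.x_mul_evalTWA, mul_assoc]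
  apply h.eval_mul_mem_range
  obtain ⟨n, rfl | rfl⟩ := m.eq_nat_or_neg
  · have := h.mem_range ((n + 1 : ℕ) : ℤ) 1
    rwa [zpower_natCast, map_one, one_mul, pow_succ', ← zpower_natCast (y := y)] at this
  · cases n with
    | zero => simpa [zpower] using h.mem_range 1 1
    | succ n =>
      obtain ⟨f, hf⟩ := h.exists_xy
      rw [zpower_neg_natCast, pow_succ', ← mul_assoc, ← hf, ← zpower_neg_natCast (x := x)]
      exact h.mem_range _ _

theorem y_mul_mem_range (h : ClassicalRel y t a x)
    {r : R} (hr : r ∈ h.normalForm.range) : y * r ∈ h.normalForm.range := by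
  obtain ⟨p, rfl⟩ := hr
  rw [normalForm_apply, Finsupp.mul_sum]
  refine sum_mem fun m _ => ?_
  beta_reduce
  rw [← mul_assoc, h.y_mul_evalTWA, mul_assoc]
  apply h.eval_mul_mem_range
  obtain ⟨n, rfl | rfl⟩ := m.eq_nat_or_neg
  · cases n with
    | zero => simpa [zpower] using h.mem_range (-1) 1
    | succ n =>
      obtain ⟨f, hf⟩ := h.exists_yx
      rw [zpower_natCast, pow_succ', ← mul_assoc, ← hf, ← zpower_natCast (y := y)]
      exact h.mem_range _ _
  · have := h.mem_range (-((n + 1 : ℕ) : ℤ)) 1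
    rwa [zpower_neg_natCast, map_one, one_mul, pow_succ', ← zpower_neg_natCast (x := x)] at this

theorem one_mem_range (h : ClassicalRel y t a x) : (1 : R) ∈ h.normalForm.range := by
  simpa [zpower] using h.mem_range 0 1

/-- The elements `evalTWA f * zpower m` span the subalgebra generated by `y, b, a, x`. -/
theorem lift_mem_range (h : ClassicalRel y t a x) {g : Gen → R} (hy : g .y = y)
    (hb : g .b = t + algebraMap QEps R Polynomial.X * a) (ha : g .a = a) (hx : g .x = x)
    (f : Free) : FreeAlgebra.lift QEps g f ∈ h.normalForm.range := by
  -- Stability under left multiplication, unlike membership, passes directly to products.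
  suffices H : ∀ r ∈ h.normalForm.range, FreeAlgebra.lift QEps g f * r ∈ h.normalForm.range by
    simpa using H 1 h.one_mem_range
  induction f using FreeAlgebra.induction with
  | grade0 c =>
    intro r hr
    rw [AlgHom.commutes, ← h.evalTWA_algebraMap]
    exact h.eval_mul_mem_range _ hr
  | grade1 i =>
    intro r hr
    rw [FreeAlgebra.lift_ι_apply]
    cases i with
    | y => rw [hy]; exact h.y_mul_mem_range hr
    | b =>
      have := h.eval_mul_mem_range (tP + algebraMap QEps _ Polynomial.X * aP) hr
      rwa [map_add, map_mul, evalTWA_tP, evalTWA_aP, evalTWA_algebraMap, ← hb] at this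
    | a =>
      have := h.eval_mul_mem_range aP hr
      rw [ha]
      rwa [evalTWA_aP] at this
    | x => rw [hx]; exact h.x_mul_mem_range hr
  | mul f g hf hg =>
    intro r hr
    rw [map_mul, mul_assoc]
    exact hf _ (hg _ hr)
  | add f g hf hg =>
    intro r hr
    rw [map_add, add_mul]
    exact add_mem (hf _ hr) (hg _ hr)

end

/-! ### Independence of the normal forms -/

section Injectivity

variable {R : Type*} [Ring R] [Algebra QEps R] {y t a x : R} (h : ClassicalRel y t a x)
  (ρ : R →+* Skew)

theorem map_evalTWA (hs : ∀ c, ρ (algebraMap QEps R c) = diag (algebraMap QEps PolyTWA c))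
    (ht : ρ t = diag tP) (ha : ρ a = diag aP) (hw : ρ (casimir y t a x) = diag wP) (p : PolyTWA) :
    ρ (h.evalTWA p) = diag p := by
  suffices H : ρ.comp h.evalTWA = diag from RingHom.congr_fun H p
  refine Polynomial.ringHom_ext (fun c => ?_) ?_
  · suffices H : (ρ.comp h.evalTWA).comp Polynomial.C = diag.comp Polynomial.C from
      RingHom.congr_fun H c
    refine Polynomial.ringHom_ext (R := Polynomial QEps) (fun c => ?_) ?_
    · suffices H : ((ρ.comp h.evalTWA).comp Polynomial.C).comp
          (Polynomial.C : Polynomial QEps →+* Polynomial (Polynomial QEps)) =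
          (diag.comp Polynomial.C).comp
          (Polynomial.C : Polynomial QEps →+* Polynomial (Polynomial QEps)) from
        RingHom.congr_fun H c
      refine Polynomial.ringHom_ext (fun c => ?_) ?_
      · exact (congrArg ρ (h.evalTWA_algebraMap c)).trans (hs c)
      · exact (congrArg ρ h.evalTWA_tP).trans ht
    · exact (congrArg ρ h.evalTWA_wP).trans hw
  · exact (congrArg ρ h.evalTWA_aP).trans ha

/-- A homomorphism to the skew Laurent ring is injective on normal forms. -/
theorem eq_zero_of_map_eq_zero
    (hs : ∀ c, ρ (algebraMap QEps R c) = diag (algebraMap QEps PolyTWA c))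
    (ht : ρ t = diag tP) (ha : ρ a = diag aP) (hw : ρ (casimir y t a x) = diag wP)
    {u : PolyTWA} (hu : u ≠ 0) (hx : ρ x = shiftOp 1) (hy : ρ y = diag u * shiftOp (-1))
    {r : R} (hr : r ∈ h.normalForm.range) (h0 : ρ r = 0) : r = 0 := by
  obtain ⟨p, rfl⟩ := hr
  choose v hv hz using exists_map_zpower ρ hu hx hy
  -- The component at `Xᵐ` of the image is `p m * v m`, and `v m ≠ 0`.
  have hp : p = 0 := by
    ext1 m
    rw [normalForm_apply, Finsupp.sum, map_sum] at h0
    have h1 := congrArg (fun s : Skew => s.coeff (Multiplicative.ofAdd m)) h0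
    simp only [map_mul, h.map_evalTWA ρ hs ht ha hw, hz, ← mul_assoc] at h1
    simp only [← map_mul, diag_mul_shiftOp, SkewMonoidAlgebra.coeff_zero, Finsupp.coe_zero,
      Pi.zero_apply] at h1
    rw [← SkewMonoidAlgebra.coeffAddEquiv_apply, map_sum, Finsupp.finsetSum_apply] at h1
    simp only [SkewMonoidAlgebra.coeffAddEquiv_apply, SkewMonoidAlgebra.coeff_single] at h1
    rw [Finset.sum_eq_single m] at h1
    · simpa [hv m] using h1
    · intro k _ hk
      exact Finsupp.single_eq_of_ne (by simpa using hk.symm)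
    · intro hm
      simp [Finsupp.notMem_support_iff.mp hm]
  rw [hp, map_zero]

end Injectivity

end ClassicalRel

/-! ## `𝔻` modulo `ħ` -/

theorem ħ_eq : ħ = proj PowerSeries.X := by
  change proj (scalarHat PowerSeries.X) = _
  rw [scalarHat, PowerSeries.map_X]

theorem algebraMap_QEps_D (c : QEps) :
    algebraMap QEps D c = proj (PowerSeries.C (algebraMap QEps Free c)) := by
  change proj (scalarHat (PowerSeries.C c)) = _
  rw [scalarHat, PowerSeries.map_C]

theorem ε_eq : ε = proj εHat := algebraMap_QEps_D _

theorem ħ_comm (d : D) : ħ * d = d * ħ := Algebra.commutes (R := K) PowerSeries.X d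

theorem ħ_pow_comm (n : ℕ) (d : D) : ħ ^ n * d = d * ħ ^ n :=
  (show Commute ħ d from ħ_comm d).pow_left n

theorem proj_eq_iff {f g : FreeHat} : proj f = proj g ↔ f - g ∈ relIdeal :=
  (RingCon.eq relIdeal.ringCon).trans (TwoSidedIdeal.rel_iff _ _ _)

theorem proj_relator {r : FreeHat} (hr : r ∈ relators) : proj r = 0 := by
  rw [← map_zero proj, proj_eq_iff, sub_zero, relIdeal, TwoSidedIdeal.mem_iInf]
  exact fun n => TwoSidedIdeal.subset_span (Or.inl hr)

/-- `𝔻` is `ħ`-adically separated. -/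
theorem eq_zero_of_forall_dvd {d : D} (h : ∀ N : ℕ, ħ ^ N ∣ d) : d = 0 := by
  obtain ⟨f, rfl⟩ := proj_surjective d
  rw [← map_zero proj, proj_eq_iff, sub_zero, relIdeal, TwoSidedIdeal.mem_iInf]
  intro n
  obtain ⟨e, he⟩ := h n
  obtain ⟨g, rfl⟩ := proj_surjective e
  rw [ħ_eq, ← map_pow, ← map_mul, proj_eq_iff, relIdeal, TwoSidedIdeal.mem_iInf] at he
  -- `f` differs from a multiple of `ħⁿ` by an element of the `n`-th ideal, which itself contains
  -- `ħⁿ`.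
  rw [← sub_add_cancel f (PowerSeries.X ^ n * g)]
  refine add_mem (he n) (TwoSidedIdeal.mul_mem_right _ _ _ (TwoSidedIdeal.subset_span ?_))
  exact Or.inr rfl

/-- The ideal `ħ𝔻`. -/
def ħIdeal : Ideal D := Ideal.span {ħ}

theorem mem_ħIdeal {d : D} : d ∈ ħIdeal ↔ ħ ∣ d := by
  rw [ħIdeal, Ideal.mem_span_singleton']
  constructor
  · rintro ⟨e, rfl⟩
    exact ⟨e, (ħ_comm e).symm⟩
  · rintro ⟨e, rfl⟩
    exact ⟨e, (ħ_comm e).symm⟩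

instance : ħIdeal.IsTwoSided where
  mul_mem_of_left e h := by
    rw [mem_ħIdeal] at h ⊢
    exact h.mul_right e

/-- The classical limit `𝔻/ħ𝔻`. -/
abbrev DMod : Type := D ⧸ ħIdeal

/-- The reduction modulo `ħ`. -/
def modH : D →+* DMod := Ideal.Quotient.mk ħIdeal

theorem modH_eq_zero {d : D} : modH d = 0 ↔ ħ ∣ d :=
  Ideal.Quotient.eq_zero_iff_mem.trans mem_ħIdeal

theorem modH_algebraMap (c : QEps) : modH (algebraMap QEps D c) = algebraMap QEps DMod c := rfl

theorem modH_proj (f : FreeHat) :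
    modH (proj f) = modH (proj (PowerSeries.C (PowerSeries.constantCoeff f))) := by
  rw [← sub_eq_zero, ← map_sub, modH_eq_zero, ← map_sub, ħ_eq]
  conv in f - _ => rw [PowerSeries.eq_X_mul_shift_add_const f]
  simp

theorem modH_proj_C (f : Free) :
    modH (proj (PowerSeries.C f)) = FreeAlgebra.lift QEps (fun i => modH (proj (genHat i))) f := by
  induction f using FreeAlgebra.induction with
  | grade0 c => rw [AlgHom.commutes, ← algebraMap_QEps_D, modH_algebraMap]
  | grade1 i => rw [FreeAlgebra.lift_ι_apply]; rfl
  | mul f g hf hg => rw [map_mul, map_mul, map_mul, map_mul, hf, hg]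
  | add f g hf hg => rw [map_add, map_add, map_add, map_add, hf, hg]

theorem x_mul_y : x * y = q * y * x + proj (divH (1 - AHat * BHat)) := by
  have := proj_relator (r := genHat .x * genHat .y -
    (qHat * genHat .y * genHat .x + divH (1 - AHat * BHat))) (by simp [relators])
  rw [map_sub, map_add, map_mul, map_mul, map_mul, sub_eq_zero] at this
  exact this

theorem a_mul_x : a * x = x * a + x := by
  have := proj_relator (r := genHat .a * genHat .x - genHat .x * genHat .a - genHat .x)
    (by simp [relators])
  rw [map_sub, map_sub, map_mul, map_mul, sub_eq_zero, sub_eq_iff_eq_add] at this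
  rw [add_comm]
  exact this

theorem b_mul_x : b * x = x * b + ε * x := by
  have := proj_relator (r := genHat .b * genHat .x - genHat .x * genHat .b - εHat * genHat .x)
    (by simp [relators])
  rw [map_sub, map_sub, map_mul, map_mul, map_mul, sub_eq_zero, sub_eq_iff_eq_add] at this
  rw [add_comm, ε_eq]
  exact this

theorem a_mul_y : a * y = y * a - y := by
  have := proj_relator (r := genHat .a * genHat .y - genHat .y * genHat .a + genHat .y)
    (by simp [relators])
  rw [map_add, map_sub, map_mul, map_mul, add_eq_zero_iff_eq_neg, sub_eq_iff_eq_add] at this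
  rw [sub_eq_add_neg, add_comm]
  exact this

theorem b_mul_y : b * y = y * b - ε * y := by
  have := proj_relator (r := genHat .b * genHat .y - genHat .y * genHat .b + εHat * genHat .y)
    (by simp [relators])
  rw [map_add, map_sub, map_mul, map_mul, map_mul, add_eq_zero_iff_eq_neg,
    sub_eq_iff_eq_add] at this
  rw [sub_eq_add_neg, add_comm, ε_eq]
  exact this

theorem a_mul_b : a * b = b * a := by
  have := proj_relator (r := genHat .a * genHat .b - genHat .b * genHat .a)
    (by simp [relators])
  rw [map_sub, map_mul, map_mul, sub_eq_zero] at this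
  exact this

theorem ε_comm (d : D) : d * ε = ε * d := (Algebra.commutes (R := QEps) Polynomial.X d).symm

theorem modH_q : modH q = 1 := by
  rw [q, modH_proj, qHat, ← map_one modH, ← map_one proj, ← map_one PowerSeries.C]
  simp [hexp, ← PowerSeries.coeff_zero_eq_constantCoeff_apply]

theorem modH_divH : modH (proj (divH (1 - AHat * BHat))) = modH (t + ε * a + ε * a) := by
  have h : PowerSeries.constantCoeff (divH (1 - AHat * BHat)) = gen .b + fε * gen .a := by
    rw [← PowerSeries.coeff_zero_eq_constantCoeff_apply]
    simp [divH, AHat, BHat, hexp, PowerSeries.coeff_mul, PowerSeries.coeff_one,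
      Finset.Nat.antidiagonal_succ, add_comm]
  rw [modH_proj, h, t, sub_add_cancel, map_add, map_mul, map_add, map_mul, ε_eq]
  rfl

theorem classicalRel_modH : ClassicalRel (modH y) (modH t) (modH a) (modH x) where
  x_mul_y := by
    rw [← map_mul, x_mul_y, map_add, modH_divH, map_mul, map_mul, modH_q, one_mul, map_add,
      map_add, ← modH_algebraMap, map_mul]
    rfl
  x_mul_a := by
    rw [← map_one modH, ← map_sub, ← map_mul, ← map_mul, sub_mul, a_mul_x, one_mul,
      add_sub_cancel_right]
  y_mul_a := by
    rw [← map_one modH, ← map_add, ← map_mul, ← map_mul, add_mul, a_mul_y, one_mul, sub_add_cancel]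
  x_mul_t := by
    rw [← map_mul, ← map_mul, t, mul_sub, sub_mul, b_mul_x, mul_assoc, a_mul_x, ← mul_assoc,
      ε_comm, mul_add, mul_assoc, add_sub_add_right_eq_sub]
  y_mul_t := by
    rw [← map_mul, ← map_mul, t, mul_sub, sub_mul, b_mul_y, mul_assoc, a_mul_y, ← mul_assoc,
      ε_comm, mul_sub, mul_assoc, sub_sub_sub_cancel_right]
  a_mul_t := by
    rw [← map_mul, ← map_mul, t, mul_sub, sub_mul, a_mul_b, ← mul_assoc, ε_comm]

theorem modH_mem_range (d : D) : modH d ∈ classicalRel_modH.normalForm.range := by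
  obtain ⟨f, rfl⟩ := proj_surjective d
  rw [modH_proj, modH_proj_C]
  refine classicalRel_modH.lift_mem_range rfl ?_ rfl rfl _
  change modH b = modH t + modH ε * modH a
  rw [← map_mul, ← map_add, t, sub_add_cancel]

/-! ## Injectivity of the homomorphism to the series over the skew Laurent ring -/

theorem toSkewH_ħ : toSkewH ħ = PowerSeries.X := by
  rw [ħ_eq, toSkewH_proj, freeHatToSkew_X]

theorem toSkewH_algebraMap (c : QEps) :
    toSkewH (algebraMap QEps D c) = PowerSeries.C (algebraMap QEps Skew c) := by
  rw [algebraMap_QEps_D, toSkewH_proj, freeHatToSkew_C, freeToSkew_algebraMap, algebraMap_skew]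

theorem toSkewH_y : toSkewH y = diagH yCoeff * shiftH (-1) := freeHatToSkew_genHat _

theorem toSkewH_x : toSkewH x = shiftH 1 := freeHatToSkew_genHat _

theorem toSkewH_a : toSkewH a = diagH (PowerSeries.C aP) :=
  (freeHatToSkew_genHat _).trans (diagH_C _).symm

theorem toSkewH_b : toSkewH b = diagH (PowerSeries.C (tP + eP * aP)) :=
  (freeHatToSkew_genHat _).trans (diagH_C _).symm

theorem toSkewH_ε : toSkewH ε = diagH (PowerSeries.C eP) := by
  rw [ε_eq, toSkewH_proj, freeHatToSkew_εHat]

theorem toSkewH_t : toSkewH t = diagH (PowerSeries.C tP) := by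
  rw [t, map_sub, map_mul, toSkewH_b, toSkewH_ε, toSkewH_a, ← map_mul, ← map_mul, ← map_sub,
    ← map_sub, add_sub_cancel_right]

theorem toSkewH_q : toSkewH q = diagH (hexp eP) := freeHatToSkew_qHat

theorem toSkewH_A : toSkewH A = diagH (hexp (-(eP * aP))) := freeHatToSkew_AHat

theorem toSkewH_Ainv : toSkewH Ainv = diagH (hexp (eP * aP)) :=
  freeHatToSkew_hexp (by
    rw [map_mul, freeToSkew_fε, freeToSkew_gen, genImage, map_mul, map_mul])

theorem freeToSkew_t : freeToSkew (gen .b - fε * gen .a) = PowerSeries.C (diag tP) := by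
  rw [map_sub, map_mul, freeToSkew_fε, freeToSkew_gen, freeToSkew_gen, genImage, genImage,
    ← map_mul, ← map_mul, ← map_sub, ← map_sub, add_sub_cancel_right]

theorem toSkewH_T : toSkewH T = diagH (hexp (-tP)) :=
  freeHatToSkew_hexp (by rw [map_neg, freeToSkew_t, map_neg, map_neg])

/-- The reduction modulo `ħ` of the homomorphism to the series over the skew Laurent ring. -/
def toSkew : D →+* Skew := PowerSeries.constantCoeff.comp toSkewH

theorem toSkew_apply (d : D) : toSkew d = PowerSeries.constantCoeff (toSkewH d) := rfl

theorem constantCoeff_diagH (f : PowerSeries PolyTWA) :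
    PowerSeries.constantCoeff (diagH f) = diag (PowerSeries.constantCoeff f) := rfl

theorem toSkew_eq_zero_of_dvd {d : D} (h : ħ ∣ d) : toSkew d = 0 := by
  obtain ⟨e, rfl⟩ := h
  rw [toSkew_apply, map_mul, toSkewH_ħ, map_mul, PowerSeries.constantCoeff_X, zero_mul]

theorem toSkew_algebraMap (c : QEps) : toSkew (algebraMap QEps D c) = algebraMap QEps Skew c := by
  rw [toSkew_apply, toSkewH_algebraMap, PowerSeries.constantCoeff_C]

theorem toSkew_a : toSkew a = diag aP := by
  rw [toSkew_apply, toSkewH_a, constantCoeff_diagH, PowerSeries.constantCoeff_C]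

theorem toSkew_t : toSkew t = diag tP := by
  rw [toSkew_apply, toSkewH_t, constantCoeff_diagH, PowerSeries.constantCoeff_C]

theorem toSkew_x : toSkew x = shiftOp 1 := by
  rw [toSkew_apply, toSkewH_x, shiftH, PowerSeries.constantCoeff_C]

theorem constantCoeff_casimirP : PowerSeries.constantCoeff casimirP =
    tP * aP + eP * aP * (aP + 1) + algebraMap QEps PolyTWA (Polynomial.C (1 / 2)) * tP := by
  rw [← PowerSeries.coeff_zero_eq_constantCoeff_apply, casimirP, coeff_zero_casimirSeries,
    Algebra.smul_def]
  congr 2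

theorem constantCoeff_yCoeff :
    PowerSeries.constantCoeff yCoeff = wP - PowerSeries.constantCoeff casimirP := by
  have : PowerSeries.constantCoeff (hexp (-(eP * (aP + 1)))) = 1 := by
    simp [hexp, ← PowerSeries.coeff_zero_eq_constantCoeff_apply]
  rw [yCoeff, map_mul, this, mul_one, map_sub, PowerSeries.constantCoeff_C]

theorem toSkew_y : toSkew y = diag (wP - PowerSeries.constantCoeff casimirP) * shiftOp (-1) := by
  rw [toSkew_apply, toSkewH_y, map_mul, constantCoeff_diagH, constantCoeff_yCoeff, shiftH,
    PowerSeries.constantCoeff_C]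

theorem toSkew_y_mul_x : toSkew (y * x) = diag (wP - PowerSeries.constantCoeff casimirP) := by
  rw [map_mul, toSkew_y, toSkew_x, mul_assoc, shiftOp_mul, neg_add_cancel, shiftOp_zero, mul_one]

theorem wP_sub_ne_zero : wP - PowerSeries.constantCoeff casimirP ≠ 0 := by
  intro h
  have h1 := congrArg (Polynomial.eval 0) h
  rw [constantCoeff_casimirP, Polynomial.algebraMap_apply] at h1
  simp only [wP, tP, aP, Polynomial.eval_sub, Polynomial.eval_add, Polynomial.eval_mul,
    Polynomial.eval_C, Polynomial.eval_X, Polynomial.eval_zero, mul_zero, zero_mul, zero_add] at h1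
  exact Polynomial.X_sub_C_ne_zero
    (Polynomial.C (Polynomial.C (1 / 2)) * Polynomial.X : Polynomial QEps)
    ((congrArg _ (map_mul (Polynomial.C : Polynomial QEps →+* _) _ _)).trans h1)

/-- The kernel of the reduction modulo `ħ` of the homomorphism to the series over the skew Laurent
ring is `ħ𝔻`. -/
theorem toSkew_eq_zero_iff {d : D} : toSkew d = 0 ↔ ħ ∣ d := by
  refine ⟨fun hd => ?_, toSkew_eq_zero_of_dvd⟩
  let ρ : DMod →+* Skew := Ideal.Quotient.lift ħIdeal toSkew
    fun e he => toSkew_eq_zero_of_dvd (mem_ħIdeal.mp he)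
  have hρ : ∀ e, ρ (modH e) = toSkew e := fun e => Ideal.Quotient.lift_mk _ _ _
  rw [← modH_eq_zero]
  refine classicalRel_modH.eq_zero_of_map_eq_zero ρ (fun c => ?_) ((hρ _).trans toSkew_t)
    ((hρ _).trans toSkew_a) ?_ wP_sub_ne_zero ((hρ _).trans toSkew_x) ((hρ _).trans toSkew_y)
    (modH_mem_range d) ((hρ d).trans hd)
  · rw [← modH_algebraMap, hρ, toSkew_algebraMap, algebraMap_skew]
  · rw [ClassicalRel.casimir, ClassicalRel.shiftTerm, ← map_mul]
    simp only [map_add, map_mul ρ, ← modH_algebraMap, hρ, toSkew_y_mul_x, toSkew_t, toSkew_a,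
      toSkew_algebraMap, algebraMap_skew, map_one]
    rw [constantCoeff_casimirP, ← map_one diag]
    simp only [← map_mul, ← map_add]
    congr 1
    rw [eP]
    ring

/-- A kernel element is `ħ e`, and cancelling `ħ` in the target puts `e` in the kernel as well.
Iterating gives divisibility by all powers of `ħ`. -/
theorem toSkewH_injective : Function.Injective toSkewH := by
  rw [injective_iff_map_eq_zero]
  intro d hd
  refine eq_zero_of_forall_dvd fun N => ?_
  induction N generalizing d with
  | zero => rw [pow_zero]; exact one_dvd _
  | succ N ih =>
    obtain ⟨e, rfl⟩ := toSkew_eq_zero_iff.mp (by rw [toSkew_apply, hd, map_zero] : toSkew d = 0)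
    rw [pow_succ']
    refine mul_dvd_mul_left ħ (ih e (PowerSeries.X_mul_cancel ?_))
    rw [mul_zero, ← toSkewH_ħ, ← map_mul, hd]

/-! ## Central elements -/

theorem mem_center_of_toSkewH {d : D} {c : PolyTW}
    (h : toSkewH d = diagH (PowerSeries.C (Polynomial.C c))) : d ∈ Subalgebra.center K D := by
  rw [Subalgebra.mem_center_iff]
  intro e
  apply toSkewH_injective
  rw [map_mul, map_mul, h, diagH_C]
  ext1 n
  rw [PowerSeries.coeff_mul_C, PowerSeries.coeff_C_mul, diag_C_comm]

theorem t_mem_center : t ∈ Subalgebra.center K D := mem_center_of_toSkewH toSkewH_t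

/-- Multiplication by a non-zero series in the commuting variables is injective. -/
theorem diagH_mul_injective {s : PowerSeries PolyTWA} (hs : s ≠ 0) {f g : PowerSeries Skew}
    (h : diagH s * f = diagH s * g) : f = g := by
  -- Left multiplication by `diagH s` acts separately on the coefficient of each `Xᵐ`, which reduces
  -- the claim to series over a commutative domain.
  let comp (m : Multiplicative ℤ) (z : PowerSeries Skew) : PowerSeries PolyTWA :=
    PowerSeries.mk fun n => (PowerSeries.coeff n z).coeff m
  have hcomp : ∀ m z, comp m (diagH s * z) = s * comp m z := by
    intro m z
    ext1 n
    rw [PowerSeries.coeff_mk, PowerSeries.coeff_mul, PowerSeries.coeff_mul,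
      ← SkewMonoidAlgebra.coeffAddEquiv_apply, map_sum, Finsupp.finsetSum_apply]
    refine Finset.sum_congr rfl fun p _ => ?_
    rw [SkewMonoidAlgebra.coeffAddEquiv_apply, diagH, PowerSeries.coeff_map, coeff_diag_mul,
      PowerSeries.coeff_mk]
  ext1 n
  ext1 m
  have := mul_left_cancel₀ hs ((hcomp m f).symm.trans ((congrArg (comp m) h).trans (hcomp m g)))
  simpa [comp] using congrArg (PowerSeries.coeff n) this

/-! ## Series in `a, t` -/

/-- Evaluation of polynomials in `a, t` in `ℚ[ε][t][w][a]`. -/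
def evalATP : MvPolynomial (Fin 2) QEps →ₐ[QEps] PolyTWA := MvPolynomial.aeval ![aP, tP]

theorem freeToSkew_evalAT (g : MvPolynomial (Fin 2) QEps) :
    freeToSkew (evalAT g) = PowerSeries.C (diag (evalATP g)) := by
  rw [evalATP, MvPolynomial.aeval_def, MvPolynomial.eval₂_eq', evalAT, map_sum, map_sum, map_sum]
  refine Finset.sum_congr rfl fun m _ => ?_
  rw [Algebra.smul_def, map_mul, map_mul, map_pow, map_pow, freeToSkew_algebraMap, freeToSkew_t,
    freeToSkew_gen, genImage, ← map_pow, ← map_pow, ← map_pow, ← map_pow, ← map_mul, ← map_mul,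
    ← map_mul, ← map_mul]
  simp [Fin.prod_univ_two]

theorem toSkewH_seriesAT (g : PowerSeries (MvPolynomial (Fin 2) QEps)) :
    toSkewH (seriesAT g) = diagH (PowerSeries.map evalATP.toRingHom g) := by
  refine seriesLift_of_const _ fun n => ?_
  rw [PowerSeries.coeff_mk, diagH, PowerSeries.coeff_map, PowerSeries.coeff_map]
  exact freeToSkew_evalAT _

theorem toSkew_seriesAT (g : PowerSeries (MvPolynomial (Fin 2) QEps)) :
    toSkew (seriesAT g) = diag (evalATP (PowerSeries.constantCoeff g)) := by
  rw [toSkew_apply, toSkewH_seriesAT, constantCoeff_diagH]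
  rfl

/-- The series `c(a,t)` in `ℚ[ε,a,t]⟦ħ⟧`. -/
def casimirAT : PowerSeries (MvPolynomial (Fin 2) QEps) :=
  casimirSeries (algebraMap QEps _ Polynomial.X) (MvPolynomial.X 0) (MvPolynomial.X 1)

/-- Both sides solve `ħ (q - 1) c = …` in a domain where `ħ (q - 1) ≠ 0`. -/
theorem map_casimirAT : PowerSeries.map evalATP.toRingHom casimirAT = casimirP := by
  have h1 := congrArg (PowerSeries.map evalATP.toRingHom) (casimirSeries_spec
    (algebraMap QEps (MvPolynomial (Fin 2) QEps) Polynomial.X)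
    (MvPolynomial.X 0) (MvPolynomial.X 1))
  have he : evalATP.toRingHom (algebraMap QEps _ Polynomial.X) = eP := evalATP.commutes _
  have ha : evalATP.toRingHom (MvPolynomial.X 0) = aP := MvPolynomial.aeval_X _ _
  have ht : evalATP.toRingHom (MvPolynomial.X 1) = tP := MvPolynomial.aeval_X _ _
  rw [← casimirAT] at h1
  simp only [map_mul, map_sub, map_add, map_one, map_rat_smul, map_hexp, PowerSeries.map_X,
    map_neg, he, ha, ht] at h1
  rw [← casimirSeries_spec] at h1
  exact mul_left_cancel₀ (mul_ne_zero PowerSeries.X_ne_zero hexp_eP_sub_one_ne_zero) h1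

/-! ### The quotient `c` and the central element `w` -/

theorem toSkewH_seriesAT_casimirAT : toSkewH (seriesAT casimirAT) = diagH casimirP := by
  rw [toSkewH_seriesAT, map_casimirAT]

theorem toSkewH_ħ_mul_q_sub_one :
    toSkewH (ħ * (q - 1)) = diagH (PowerSeries.X * (hexp eP - 1)) := by
  rw [map_mul, map_sub, map_one, toSkewH_ħ, toSkewH_q, map_mul, map_sub, map_one, diagH_X]

theorem ħ_mul_q_sub_one_mul_casimir : (ħ * (q - 1)) * seriesAT casimirAT =
    q * Ainv + A * T - (1 / 2 : ℚ) • ((1 + T) * (q + 1)) := by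
  apply toSkewH_injective
  rw [map_mul, toSkewH_ħ_mul_q_sub_one, toSkewH_seriesAT_casimirAT, ← map_mul, casimirP,
    casimirSeries_spec]
  simp only [map_sub, map_add, map_mul, map_rat_smul, map_one, toSkewH_q, toSkewH_A, toSkewH_Ainv,
    toSkewH_T]

theorem ħ_mul_q_sub_one_cancel {c c' : D} (h : (ħ * (q - 1)) * c = (ħ * (q - 1)) * c') :
    c = c' := by
  apply toSkewH_injective
  have := congrArg toSkewH h
  rw [map_mul _ _ c, map_mul _ _ c', toSkewH_ħ_mul_q_sub_one] at this
  exact diagH_mul_injective (mul_ne_zero PowerSeries.X_ne_zero hexp_eP_sub_one_ne_zero) this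

theorem toSkewH_w : toSkewH (y * Ainv * x + seriesAT casimirAT) = diagH (PowerSeries.C wP) := by
  rw [map_add, map_mul, map_mul, toSkewH_y, toSkewH_Ainv, toSkewH_x, toSkewH_seriesAT_casimirAT,
    mul_assoc (diagH _), shiftH_mul_diagH, ← mul_assoc, ← map_mul, mul_assoc, shiftH_mul,
    neg_add_cancel, shiftH_zero, mul_one, ← map_add]
  congr 1
  rw [map_hexp, map_mul, shift_eP, shift_aP, Int.cast_neg, Int.cast_one, sub_neg_eq_add, yCoeff,
    mul_assoc, mul_comm (hexp (-_)), hexp_mul_hexp_neg, mul_one, sub_add_cancel]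

theorem congrModH_w :
    CongrModH (y * Ainv * x + seriesAT casimirAT) (y * x + seriesAT casimirAT) := by
  have h1 : toSkew Ainv = 1 := by
    rw [toSkew_apply, toSkewH_Ainv, constantCoeff_diagH, ← map_one diag]
    simp [hexp, ← PowerSeries.coeff_zero_eq_constantCoeff_apply]
  rw [CongrModH, ← toSkew_eq_zero_iff, map_sub, map_add, map_add, map_mul, map_mul, map_mul, h1,
    mul_one, sub_self]

/-! ## The centre modulo `ħ` -/

/-- A periodic polynomial takes one value at all natural numbers, which are infinitely many points
of a domain of characteristic zero. -/
theorem eq_C_of_shift_eq {p : PolyTWA} (h : shift 1 p = p) : p = Polynomial.C (p.eval 0) := by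
  have hn : ∀ n : ℕ, p.eval (n : PolyTW) = p.eval 0 := by
    intro n
    induction n with
    | zero => rw [Nat.cast_zero]
    | succ n ih =>
      rw [← ih]
      conv_lhs => rw [← h]
      rw [shift_apply, Polynomial.taylor_eval]
      congr 1
      push_cast
      ring
  refine Polynomial.eq_of_infinite_eval_eq _ _
    ((Set.infinite_range_of_injective (Nat.cast_injective (R := PolyTW))).mono ?_)
  rintro _ ⟨n, rfl⟩
  change p.eval _ = Polynomial.eval _ _
  rw [hn, Polynomial.eval_C]

theorem shift_eq_of_commute {p : PolyTWA} (h : diag p * shiftOp 1 = shiftOp 1 * diag p) :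
    shift 1 p = p := by
  rw [shiftOp_mul_diag, diag_mul_shiftOp, diag_mul_shiftOp] at h
  exact (SkewMonoidAlgebra.single_injective _ h).symm

/-- At `Xᵐ` the hypothesis reads `f_m (a - m) = a f_m`, so `m f_m = 0`. -/
theorem eq_diag_of_commute {f : Skew} (h : f * diag aP = diag aP * f) : f = diag (f.coeff 1) := by
  ext1 m
  rw [diag_apply]
  by_cases hm : m = 1
  · rw [hm, SkewMonoidAlgebra.coeff_single, Finsupp.single_eq_same]
  · rw [SkewMonoidAlgebra.coeff_single, Finsupp.single_eq_of_ne hm]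
    have h1 := congrArg (fun s : Skew => s.coeff m) h
    simp only [coeff_mul_diag, coeff_diag_mul, shift_aP] at h1
    have h2 : f.coeff m * ((m.toAdd : ℤ) : PolyTWA) = 0 := by linear_combination -h1
    refine (mul_eq_zero.mp h2).resolve_right ?_
    exact Int.cast_ne_zero.mpr hm

theorem exists_toSkew_eq_of_mem_center {z : D} (hz : z ∈ Subalgebra.center K D) :
    ∃ p : PolyTW, toSkew z = diag (Polynomial.C p) := by
  rw [Subalgebra.mem_center_iff] at hz
  have ha : toSkew z * diag aP = diag aP * toSkew z := by
    rw [← toSkew_a, ← map_mul, ← map_mul, hz]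
  have hx : toSkew z * shiftOp 1 = shiftOp 1 * toSkew z := by
    rw [← toSkew_x, ← map_mul, ← map_mul, hz]
  have h1 := eq_diag_of_commute ha
  rw [h1] at hx
  exact ⟨_, h1.trans (congrArg diag (eq_C_of_shift_eq (shift_eq_of_commute hx)))⟩

/-! ### Generation of the centre by `t` and `w'` -/

theorem subalgebra_eq_top {S : Subalgebra QEps PolyTW} (ht : tTW ∈ S) (hw : wTW ∈ S)
    (p : PolyTW) : p ∈ S := by
  have hC : ∀ r : Polynomial QEps, (Polynomial.C r : Polynomial (Polynomial QEps)) ∈ S := by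
    intro r
    induction r using Polynomial.induction_on' with
    | add r s hr hs => rw [map_add]; exact S.add_mem hr hs
    | monomial n c =>
      rw [← Polynomial.C_mul_X_pow_eq_monomial, map_mul, map_pow]
      exact S.mul_mem (S.algebraMap_mem c) (S.pow_mem ht n)
  induction p using Polynomial.induction_on' with
  | add p q hp hq => exact S.add_mem hp hq
  | monomial n r =>
    rw [← Polynomial.C_mul_X_pow_eq_monomial]
    exact S.mul_mem (hC r) (S.pow_mem hw n)

/-- The reduction modulo `ħ` as a homomorphism of `ℚ[ε]`-algebras. -/
def toSkewAlg : D →ₐ[QEps] Skew := { toSkew with commutes' := toSkew_algebraMap }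

/-- The inclusion of `ℚ[ε][t][w]` in the skew Laurent ring. -/
def diagC : PolyTW →ₐ[QEps] Skew :=
  { diag.comp Polynomial.C with commutes' := fun _ => rfl }

theorem eval_zero_evalATP_mem {S : Subalgebra QEps PolyTW} (ht : tTW ∈ S)
    (g : MvPolynomial (Fin 2) QEps) : Polynomial.eval 0 (evalATP g) ∈ S := by
  induction g using MvPolynomial.induction_on with
  | C c =>
    have : evalATP (MvPolynomial.C c) = Polynomial.C (algebraMap QEps PolyTW c) :=
      evalATP.commutes c
    rw [this, Polynomial.eval_C]
    exact S.algebraMap_mem c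
  | add p q hp hq => rw [map_add, Polynomial.eval_add]; exact S.add_mem hp hq
  | mul_X p i hp =>
    rw [map_mul, Polynomial.eval_mul]
    refine S.mul_mem hp ?_
    rw [evalATP, MvPolynomial.aeval_X]
    fin_cases i
    · simp [aP, S.zero_mem]
    · simpa [tP] using ht

section Generation

variable {w' : D} {g : PowerSeries (MvPolynomial (Fin 2) QEps)}

/-- Modulo `ħ`, polynomials in `t` and `w'` exhaust `ℚ[ε][t][w]`. -/
theorem exists_mem_adjoin (hw : w' ∈ Subalgebra.center K D)
    (hg : CongrModH w' (y * x + seriesAT g)) (p : PolyTW) :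
    ∃ v ∈ Algebra.adjoin QEps {t, w'}, toSkew v = diag (Polynomial.C p) := by
  let S : Subalgebra QEps PolyTW := ((Algebra.adjoin QEps {t, w'}).map toSkewAlg).comap diagC
  suffices H : p ∈ S by
    obtain ⟨v, hv, e⟩ := H
    exact ⟨v, hv, e⟩
  have ht : tTW ∈ S := ⟨t, Algebra.subset_adjoin (by simp), toSkew_t⟩
  refine subalgebra_eq_top ht ?_ p
  obtain ⟨p₀, hp₀⟩ := exists_toSkew_eq_of_mem_center hw
  have hp : p₀ ∈ S := ⟨w', Algebra.subset_adjoin (by simp), hp₀⟩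
  have h1 : toSkew w' = diag (wP - evalATP (PowerSeries.constantCoeff casimirAT)
      + evalATP (PowerSeries.constantCoeff g)) := by
    rw [CongrModH, ← toSkew_eq_zero_iff, map_sub, sub_eq_zero] at hg
    rw [hg, map_add, toSkew_y_mul_x, toSkew_seriesAT, ← map_casimirAT,
      map_add]
    rfl
  -- Centrality makes the image `p₀` of `w'` free of `a`, so setting `a = 0` loses nothing and
  -- exhibits `w` as `p₀` plus a polynomial in `t`.
  have h2 := congrArg (Polynomial.eval 0) (diag_injective (hp₀.symm.trans h1))
  rw [Polynomial.eval_C, Polynomial.eval_add, Polynomial.eval_sub, wP, Polynomial.eval_C] at h2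
  have h3 := S.sub_mem (S.add_mem hp (eval_zero_evalATP_mem ht
    (PowerSeries.constantCoeff casimirAT)))
    (eval_zero_evalATP_mem ht (PowerSeries.constantCoeff g))
  rw [h2] at h3
  convert h3 using 1
  ring

theorem adjoin_le_center (hw : w' ∈ Subalgebra.center K D) {v : D}
    (hv : v ∈ Algebra.adjoin QEps {t, w'}) :
    v ∈ Subalgebra.center K D := by
  induction hv using Algebra.adjoin_induction with
  | mem v hv =>
    rcases hv with rfl | rfl
    · exact t_mem_center
    · exact hw
  | algebraMap c =>
    rw [Subalgebra.mem_center_iff]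
    exact fun d => (Algebra.commutes c d).symm
  | add u v _ _ hu hv => exact add_mem hu hv
  | mul u v _ _ hu hv => exact mul_mem hu hv

theorem exists_remainder (hw : w' ∈ Subalgebra.center K D)
    (hg : CongrModH w' (y * x + seriesAT g))
    (z : Subalgebra.center K D) :
    ∃ (v : D) (z' : Subalgebra.center K D), v ∈ Algebra.adjoin QEps {t, w'} ∧
      (z : D) = v + ħ * z' := by
  obtain ⟨p, hp⟩ := exists_toSkew_eq_of_mem_center z.2
  obtain ⟨v, hv, hvp⟩ := exists_mem_adjoin hw hg p
  obtain ⟨e, he⟩ : ħ ∣ (z : D) - v := by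
    rw [← toSkew_eq_zero_iff, map_sub, hp, hvp, sub_self]
  have hc : (z : D) - v ∈ Subalgebra.center K D := sub_mem z.2 (adjoin_le_center hw hv)
  rw [he, Subalgebra.mem_center_iff] at hc
  refine ⟨v, ⟨e, ?_⟩, hv, by rw [← he, add_sub_cancel]⟩
  rw [Subalgebra.mem_center_iff]
  intro d
  -- The quotient `e` is central because `ħ e` is, and `ħ` can be cancelled in the image.
  apply toSkewH_injective
  apply PowerSeries.X_mul_cancel
  rw [← toSkewH_ħ, ← map_mul, ← map_mul, ← mul_assoc, ← mul_assoc, ħ_comm d, mul_assoc, hc]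

theorem isTopologicallyGeneratedBy_center (hw : w' ∈ Subalgebra.center K D)
    (hg : CongrModH w' (y * x + seriesAT g)) :
    IsTopologicallyGeneratedBy (Subalgebra.center K D) {t, w'} := by
  intro z
  constructor
  · intro hz
    choose v r hv hr using exists_remainder hw hg
    -- Iterated remainders: `z = ∑_{n<N} v(s n) ħⁿ + ħᴺ s(N)`.
    let s : ℕ → Subalgebra.center K D := fun n => r^[n] ⟨z, hz⟩
    refine ⟨fun n => v (s n), fun n => hv _, fun N => ⟨s N, ?_⟩⟩
    induction N with
    | zero => simp [s]
    | succ N ih =>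
      have hs : s (N + 1) = r (s N) := Function.iterate_succ_apply' _ _ _
      rw [Finset.sum_range_succ, ← sub_sub, ih, hs, sub_eq_iff_eq_add, pow_succ, mul_assoc]
      conv_lhs => rw [hr (s N), mul_add, ħ_pow_comm, add_comm]
  · rintro ⟨p, hp, hs⟩
    rw [Subalgebra.mem_center_iff]
    intro d
    rw [← sub_eq_zero]
    -- The partial sums are central, so the commutator of `d` with `z` only sees the tail and is
    -- divisible by every `ħᴺ`.
    refine eq_zero_of_forall_dvd fun N => ?_
    obtain ⟨e, he⟩ := hs N
    have hc : ∑ n ∈ Finset.range N, p n * ħ ^ n ∈ Subalgebra.center K D := by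
      refine sum_mem fun n _ => mul_mem (adjoin_le_center hw (hp n)) (pow_mem ?_ n)
      exact (Subalgebra.center K D).algebraMap_mem _
    rw [Subalgebra.mem_center_iff] at hc
    refine ⟨d * e - e * d, ?_⟩
    rw [sub_eq_iff_eq_add] at he
    rw [he, mul_add, add_mul, hc, add_sub_add_right_eq_sub, mul_sub, mul_assoc, ← mul_assoc d,
      ← ħ_pow_comm, mul_assoc]

end Generation

end QDouble

end

theorem theorem7p1 :
    t ∈ Subalgebra.center K D ∧
    -- `c` is the quotient in the definition of `w`, and `w = y A⁻¹ x + c`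
    (∃ c : D,
      (ħ * (q - 1)) * c = q * Ainv + A * T - (1 / 2 : ℚ) • ((1 + T) * (q + 1)) ∧
      (∀ c' : D,
        (ħ * (q - 1)) * c' = q * Ainv + A * T - (1 / 2 : ℚ) • ((1 + T) * (q + 1)) → c' = c) ∧
      y * Ainv * x + c ∈ Subalgebra.center K D ∧
      ∃ g : PowerSeries (MvPolynomial (Fin 2) QEps),
        CongrModH (y * Ainv * x + c) (y * x + seriesAT g)) ∧
    (∀ w' : D, w' ∈ Subalgebra.center K D →
      (∃ g : PowerSeries (MvPolynomial (Fin 2) QEps), CongrModH w' (y * x + seriesAT g)) →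
      IsTopologicallyGeneratedBy (Subalgebra.center K D) {t, w'}) :=
  ⟨t_mem_center,
    ⟨seriesAT casimirAT, ħ_mul_q_sub_one_mul_casimir,
      fun _ h => ħ_mul_q_sub_one_cancel (h.trans ħ_mul_q_sub_one_mul_casimir.symm),
      mem_center_of_toSkewH toSkewH_w, casimirAT, congrModH_w⟩,
    fun _ hw ⟨_, hg⟩ => isTopologicallyGeneratedBy_center hw hg⟩
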